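/- Let $k$ be a field, and let $S=k[y_1,\dots,y_s]$ and $R=k[x_0,\dots,x_n]$ be standard graded polynomial rings. Let $f_1,\dots,f_s\in R$ be homogeneous polynomials, $\deg f_i=e_i$, that form an $R$-regular sequence. Let $I=(g_1,\dots,g_r)\subseteq S$ be an ideal, let $p_i=g_i(f_1,\dots,f_s)$, and let $J=(p_1,\dots,p_r)\subseteq R$. Write $\beta^S_{i,j}(M)$ for the graded Betti numbers of a finitely generated graded $S$-module $M$, that is, the number of generators of degree $j$ of the $i$-th free module in a minimal graded free resolution of $M$, and similarly over $R$. If $I$ is a monomial ideal and $M$ is $I$ or $S/I$, write $\beta^S_{i,a}(M)$, $a\in\mathbb N^s$, for the multigraded Betti numbers, where $y_i$ has the $i$-th unit vector as its degree, so that $\beta^S_{i,j}(M)=\sum_{|a|=j}\beta^S_{i,a}(M)$. (1) Suppose that $e_1=\dots=e_s=d$ and that $I$ is homogeneous. Then $I$ and $J$ have the same graded Betti numbers up to the degree shift $j\mapsto dj$: for all $i,m$, $$\beta^R_{i,m}(J)=\sum_{j:\,dj=m}\beta^S_{i,j}(I),\qquad \beta^R_{i,m}(R/J)=\sum_{j:\,dj=m}\beta^S_{i,j}(S/I).$$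 In particular, if $s\ge 1$ (so that $d\geq 1$), then $\beta^R_{i,dj}(J)=\beta^S_{i,j}(I)$ for all $i,j$, and $\beta^R_{i,m}(J)=0$ if $d\nmid m$. Moreover, $S/I$ is a Cohen–Macaulay ring if and only if $R/J$ is a Cohen–Macaulay ring. (2) Suppose that $I$ is a monomial ideal, with no condition on the degrees $e_i$. Then $I$ and $J$ have the same graded Betti numbers up to the shift of degrees $a\mapsto\sum_l a_le_l$: for all $i,m$, $$\beta^R_{i,m}(J)=\sum_{a\in\mathbb N^s:\ \sum_l a_le_l=m}\beta^S_{i,a}(I),\qquad \beta^R_{i,m}(R/J)=\sum_{a\in\mathbb N^s:\ \sum_l a_le_l=m}\beta^S_{i,a}(S/I).$$ Again, $S/I$ is Cohen–Macaulay if and only if $R/J$ is Cohen–Macaulay. -/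

import Mathlib

/-- A minimal graded free resolution of a module `M` over the polynomial ring `k[x_i : i ∈ σ]`.
The variable `x_i` has degree `w i ∈ A`, and `𝓜 a` is the component of degree `a` of `M`.
The resolution is
`⋯ → F 2 → F 1 → F 0 → M → 0`, where `F i` is free with a finite homogeneous basis whose
`b`-th member has degree `deg i b`, and the map `F (i + 1) → F i` is given by the matrix `d i`. -/
structure MinimalGradedFreeResolution {σ A k M : Type*} [AddCommMonoid A] [Field k]
    [AddCommGroup M] [Module k M] [Module (MvPolynomial σ k) M]
    (w : σ → A) (𝓜 : A → Submodule k M) where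
  /-- The rank of the free module in homological degree `i`. -/
  rank : ℕ → ℕ
  /-- The degrees of the basis elements. -/
  deg : (i : ℕ) → Fin (rank i) → A
  /-- The matrices of the differentials. -/
  d : (i : ℕ) → Matrix (Fin (rank i)) (Fin (rank (i + 1))) (MvPolynomial σ k)
  /-- The augmentation. -/
  aug : (Fin (rank 0) → MvPolynomial σ k) →ₗ[MvPolynomial σ k] M
  /-- The augmentation is homogeneous of degree zero. -/
  aug_mem : ∀ b, aug (Pi.single b 1) ∈ 𝓜 (deg 0 b)
  /-- The differentials are homogeneous of degree zero. -/
  d_homogeneous : ∀ i b c (m : σ →₀ ℕ), MvPolynomial.coeff m (d i b c) ≠ 0 →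
    Finsupp.weight w m + deg i b = deg (i + 1) c
  aug_surjective : Function.Surjective aug
  exact_zero : Function.Exact (d 0).mulVecLin aug
  exact_succ : ∀ i, Function.Exact (d (i + 1)).mulVecLin (d i).mulVecLin
  /-- Minimality: the entries of the differentials lie in the ideal generated by the variables. -/
  minimal : ∀ i b c, MvPolynomial.constantCoeff (d i b c) = 0

/-- The number of basis elements of degree `a` in homological degree `i`. -/
noncomputable def MinimalGradedFreeResolution.betti {σ A k M : Type*} [AddCommMonoid A] [Field k]
    [AddCommGroup M] [Module k M] [Module (MvPolynomial σ k) M]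
    {w : σ → A} {𝓜 : A → Submodule k M} (F : MinimalGradedFreeResolution w 𝓜)
    (i : ℕ) (a : A) : ℕ :=
  Nat.card {b : Fin (F.rank i) // F.deg i b = a}

/-- The graded Betti numbers of the graded module `M` are well defined and equal to `β i a`:
there is a minimal graded free resolution, and every minimal graded free resolution has exactly
`β i a` basis elements of degree `a` in homological degree `i`. -/
def HasGradedBettiNumbers {σ A k M : Type*} [AddCommMonoid A] [Field k]
    [AddCommGroup M] [Module k M] [Module (MvPolynomial σ k) M]
    (w : σ → A) (𝓜 : A → Submodule k M) (β : ℕ → A → ℕ) : Prop :=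
  Nonempty (MinimalGradedFreeResolution w 𝓜) ∧
    ∀ F : MinimalGradedFreeResolution w 𝓜, ∀ i a, F.betti i a = β i a

/-- The grading of an ideal `I` of a polynomial ring, `I_a = I ∩ S_a`. -/
noncomputable def idealGrading {σ A k : Type*} [AddCommMonoid A] [Field k] (w : σ → A)
    (I : Ideal (MvPolynomial σ k)) (a : A) : Submodule k I :=
  (MvPolynomial.weightedHomogeneousSubmodule k w a).comap (I.subtype.restrictScalars k)

/-- The grading of a quotient `S/I` of a polynomial ring, by the images of the `S_a`. -/
noncomputable def quotientGrading {σ A k : Type*} [AddCommMonoid A] [Field k] (w : σ → A)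
    (I : Ideal (MvPolynomial σ k)) (a : A) : Submodule k (MvPolynomial σ k ⧸ I) :=
  (MvPolynomial.weightedHomogeneousSubmodule k w a).map (Ideal.Quotient.mkₐ k I).toLinearMap

/-- Reindexing a table of Betti numbers along a map `φ` of degrees:
`β'_{i,b} = ∑_{φ a = b} β_{i,a}`. -/
noncomputable def regradeBetti {A B : Type*} (φ : A → B) (β : ℕ → A → ℕ) (i : ℕ) (b : B) : ℕ :=
  ∑ᶠ a ∈ {a | φ a = b}, β i a

/-- An ideal of a polynomial ring that is generated by monomials. -/
def IsMonomialIdeal {σ k : Type*} [Field k] (I : Ideal (MvPolynomial σ k)) : Prop :=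
  ∃ E : Set (σ →₀ ℕ), I = Ideal.span ((fun m => MvPolynomial.monomial m (1 : k)) '' E)

/-- A Cohen–Macaulay local ring: Noetherian, with a regular sequence in the maximal ideal whose
length is the Krull dimension. -/
def IsCohenMacaulayLocal (A : Type*) [CommRing A] [IsLocalRing A] : Prop :=
  IsNoetherianRing A ∧ ∃ rs : List A, (∀ r ∈ rs, r ∈ IsLocalRing.maximalIdeal A) ∧
    RingTheory.Sequence.IsRegular A rs ∧ ((rs.length : ℕ∞) : WithBot ℕ∞) = ringKrullDim A

/-- A Cohen–Macaulay ring: Noetherian, with all localizations at maximal ideals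
Cohen–Macaulay. -/
def IsCohenMacaulay (A : Type*) [CommRing A] : Prop :=
  IsNoetherianRing A ∧ ∀ (𝔪 : Ideal A) [𝔪.IsMaximal],
    IsCohenMacaulayLocal (Localization.AtPrime 𝔪)

attribute [local instance] MvPolynomial.gradedAlgebra

/-! The substitution `y_i ↦ f_i` makes `R` an `S`-algebra with `J = IR`, and everything rests on `R`
being free over `S` (`free_of_isRegular_ofFn`). Choose monomials of `R` whose classes form a
`k`-basis of `R/(f)`. They span `R` over `S` by induction on the degree, because a nonzero `f_i` has
positive degree. They are independent because a relation over `S` can be reduced modulo `f_1` and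
then divided by `f_1`, a nonzerodivisor (`eq_zero_of_sum_aeval_smul_eq_zero`).

Betti numbers: base change of a minimal resolution to `R` stays exact by freeness and stays minimal
because the `f_i` have no constant term. A basis element of degree `a` acquires the degree `φ a`,
where `φ` is `a ↦ d * a` or `a ↦ ∑ a_l e_l` (`baseChange`). Passing from multidegrees to total
degrees is the same argument with `R = S`. Since `HasGradedBettiNumbers` speaks of all minimal
resolutions, existence (`nonempty_minimalGradedFreeResolution`) and uniqueness (`betti_eq`) are
proved as well.

Cohen–Macaulayness: `S/I → R/J` is faithfully flat, and the property descends along such maps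
(`of_flat_isLocalHom`). For the converse, `R/J` is the quotient of the Cohen–Macaulay ring
`(S/I)[x_0, …, x_n]` by the `s` graph equations `y_i = f_i(x)`. Going-down for `S → R` and the
height `n + 1` of the maximal ideals of `R` show that the local dimensions drop by at least `s`, the
most that `s` equations can achieve, so these equations form a regular sequence locally
(`of_surjective_mvPolynomial`). -/

open MvPolynomial

/-! ### Homogeneous components of vectors of polynomials -/

/-- The sum of the terms of `p` whose exponents satisfy `P`. -/
noncomputable def MvPolynomial.filterTerms {σ k : Type*} [CommSemiring k] (P : (σ →₀ ℕ) → Prop)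
    (p : MvPolynomial σ k) : MvPolynomial σ k := by
  classical exact ∑ m ∈ p.support with P m, monomial m (coeff m p)

section FilterTerms

variable {σ k : Type*} [CommSemiring k]

open Classical in
theorem MvPolynomial.coeff_filterTerms (P : (σ →₀ ℕ) → Prop) (p : MvPolynomial σ k)
    (m : σ →₀ ℕ) : coeff m (filterTerms P p) = if P m then coeff m p else 0 := by
  simp only [filterTerms, coeff_sum, coeff_monomial, Finset.sum_ite_eq', Finset.mem_filter,
    mem_support_iff]
  by_cases h : coeff m p = 0 <;> simp [h]

theorem MvPolynomial.filterTerms_add (P : (σ →₀ ℕ) → Prop) (p q : MvPolynomial σ k) :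
    filterTerms P (p + q) = filterTerms P p + filterTerms P q := by
  classical
  ext m
  simp only [coeff_filterTerms, coeff_add]
  split_ifs <;> simp

theorem MvPolynomial.filterTerms_zero (P : (σ →₀ ℕ) → Prop) :
    filterTerms P (0 : MvPolynomial σ k) = 0 := by
  classical
  ext m
  simp [coeff_filterTerms]

theorem MvPolynomial.filterTerms_sum {ι : Type*} (P : (σ →₀ ℕ) → Prop) (s : Finset ι)
    (p : ι → MvPolynomial σ k) :
    filterTerms P (∑ i ∈ s, p i) = ∑ i ∈ s, filterTerms P (p i) :=
  map_sum (⟨⟨filterTerms P, filterTerms_zero P⟩, filterTerms_add P⟩ :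
    MvPolynomial σ k →+ MvPolynomial σ k) p s

/-- The condition is stated with an equivalence between predicates, not with a difference of
degrees, so that degrees may lie in a monoid without cancellation. -/
theorem MvPolynomial.filterTerms_mul {P Q : (σ →₀ ℕ) → Prop} {p : MvPolynomial σ k}
    (h : ∀ m, coeff m p ≠ 0 → ∀ m', Q m' ↔ P (m + m')) (q : MvPolynomial σ k) :
    filterTerms P (p * q) = p * filterTerms Q q := by
  classical
  ext n
  have key : ∀ x ∈ Finset.HasAntidiagonal.antidiagonal n,
      coeff x.1 p * coeff x.2 (filterTerms Q q) =
      if P n then coeff x.1 p * coeff x.2 q else 0 := by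
    intro x hx
    rw [Finset.HasAntidiagonal.mem_antidiagonal] at hx
    by_cases hp : coeff x.1 p = 0
    · simp [hp]
    · rw [coeff_filterTerms, ← hx, mul_ite, mul_zero]
      exact if_congr (h _ hp _) rfl rfl
  rw [coeff_filterTerms, coeff_mul, coeff_mul, Finset.sum_congr rfl key]
  split_ifs <;> simp

end FilterTerms

section GradedVectors

variable {σ A k ι κ μ : Type*} [AddCommMonoid A] [Field k]

/-- The vector `v` is homogeneous of degree `a`, where the `b`-th basis vector has degree
`deg b`. -/
def IsHomogeneousVec (w : σ → A) (deg : ι → A) (a : A) (v : ι → MvPolynomial σ k) : Prop :=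
  ∀ b m, coeff m (v b) ≠ 0 → Finsupp.weight w m + deg b = a

/-- The matrix `D` defines a homogeneous map of degree zero. -/
def IsHomogeneousMatrix (w : σ → A) (deg : ι → A) (deg' : κ → A)
    (D : Matrix ι κ (MvPolynomial σ k)) : Prop :=
  ∀ b c m, coeff m (D b c) ≠ 0 → Finsupp.weight w m + deg b = deg' c

/-- The component of degree `a` of a vector. -/
noncomputable def gradedPart (w : σ → A) (deg : ι → A) (a : A) (v : ι → MvPolynomial σ k) :
    ι → MvPolynomial σ k :=
  fun b => filterTerms (fun m => Finsupp.weight w m + deg b = a) (v b)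

variable {w : σ → A} {deg : ι → A} {deg' : κ → A} {deg'' : μ → A}

theorem isHomogeneousVec_gradedPart (a : A) (v : ι → MvPolynomial σ k) :
    IsHomogeneousVec w deg a (gradedPart w deg a v) := by
  classical
  intro b m h
  rw [gradedPart, coeff_filterTerms] at h
  by_contra h'
  simp [h'] at h

theorem IsHomogeneousVec.gradedPart_self {a : A} {v : ι → MvPolynomial σ k}
    (h : IsHomogeneousVec w deg a v) : gradedPart w deg a v = v := by
  classical
  funext b
  ext m
  rw [gradedPart, coeff_filterTerms, ite_eq_left_iff]
  intro h'
  by_contra h''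
  exact h' (h b m (Ne.symm h''))

theorem IsHomogeneousVec.gradedPart_of_ne {a a' : A} {v : ι → MvPolynomial σ k}
    (h : IsHomogeneousVec w deg a v) (ha : a ≠ a') : gradedPart w deg a' v = 0 := by
  classical
  funext b
  ext m
  rw [gradedPart, coeff_filterTerms, Pi.zero_apply, coeff_zero, ite_eq_right_iff]
  intro h'
  by_contra h''
  exact ha ((h b m h'').symm.trans h')

theorem gradedPart_add (a : A) (u v : ι → MvPolynomial σ k) :
    gradedPart w deg a (u + v) = gradedPart w deg a u + gradedPart w deg a v :=
  funext fun _ => filterTerms_add _ _ _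

theorem gradedPart_zero (a : A) :
    gradedPart w deg a (0 : ι → MvPolynomial σ k) = 0 :=
  funext fun _ => filterTerms_zero _

theorem exists_sum_gradedPart [Finite ι] (w : σ → A) (deg : ι → A) (v : ι → MvPolynomial σ k) :
    ∃ T : Finset A, v = ∑ a ∈ T, gradedPart w deg a v := by
  classical
  have := Fintype.ofFinite ι
  refine ⟨Finset.univ.biUnion fun b => (v b).support.image fun m => Finsupp.weight w m + deg b, ?_⟩
  funext b
  ext m
  simp only [Finset.sum_apply, coeff_sum, gradedPart, coeff_filterTerms, Finset.sum_ite_eq,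
    Finset.mem_biUnion, Finset.mem_univ, true_and, Finset.mem_image, mem_support_iff]
  rw [eq_comm, ite_eq_left_iff]
  intro h
  by_contra h'
  exact h ⟨b, m, Ne.symm h', rfl⟩

theorem IsHomogeneousMatrix.mulVec_gradedPart [Fintype κ] {D : Matrix ι κ (MvPolynomial σ k)}
    (hD : IsHomogeneousMatrix w deg deg' D) (a : A) (u : κ → MvPolynomial σ k) :
    D.mulVec (gradedPart w deg' a u) = gradedPart w deg a (D.mulVec u) := by
  funext b
  simp only [Matrix.mulVec, dotProduct, gradedPart, filterTerms_sum]
  refine Finset.sum_congr rfl fun c _ => (filterTerms_mul (fun m hm m' => ?_) _).symm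
  rw [← hD b c m hm, map_add, ← add_assoc, add_comm (Finsupp.weight w m)]

theorem IsHomogeneousMatrix.isHomogeneousVec_col {D : Matrix ι κ (MvPolynomial σ k)}
    (hD : IsHomogeneousMatrix w deg deg' D) (c : κ) :
    IsHomogeneousVec w deg (deg' c) (D.col c) :=
  fun b m h => hD b c m h

theorem IsHomogeneousMatrix.mul [Fintype κ] {D : Matrix ι κ (MvPolynomial σ k)}
    {E : Matrix κ μ (MvPolynomial σ k)} (hD : IsHomogeneousMatrix w deg deg' D)
    (hE : IsHomogeneousMatrix w deg' deg'' E) : IsHomogeneousMatrix w deg deg'' (D * E) := by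
  intro b c
  have h : (D * E).col c = D.mulVec (E.col c) := rfl
  have h' := (hE.isHomogeneousVec_col c).gradedPart_self
  have := isHomogeneousVec_gradedPart (w := w) (deg := deg) (deg'' c) ((D * E).col c)
  rw [h, ← hD.mulVec_gradedPart, h', ← h] at this
  exact this b

/-- A homogeneous matrix commutes with taking components, so the component of degree `a` of any
preimage is again a preimage. This is how lifts are made homogeneous. -/
theorem IsHomogeneousMatrix.exists_mulVec_eq [Fintype κ] {D : Matrix ι κ (MvPolynomial σ k)}
    (hD : IsHomogeneousMatrix w deg deg' D) {a : A} {v : ι → MvPolynomial σ k}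
    (hv : IsHomogeneousVec w deg a v) (h : v ∈ Set.range D.mulVec) :
    ∃ u, IsHomogeneousVec w deg' a u ∧ D.mulVec u = v := by
  obtain ⟨u, rfl⟩ := h
  exact ⟨_, isHomogeneousVec_gradedPart a u, by rw [hD.mulVec_gradedPart, hv.gradedPart_self]⟩

end GradedVectors

/-! ### Graded modules and existence of minimal resolutions -/

/-- The sets `H a` consist of homogeneous elements of degree `a` of a graded module: there are
projections onto them, multiplication by monomials shifts the degree, and they generate the
module. -/
structure IsGradedFamily {σ A : Type*} (k : Type*) {M : Type*} [AddCommMonoid A]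
    [Field k] [AddCommGroup M]
    [Module (MvPolynomial σ k) M] (w : σ → A) (H : A → Set M) : Prop where
  exists_proj : ∃ p : A → M →+ M, (∀ a, ∀ x ∈ H a, p a x = x) ∧
    ∀ a b, ∀ x ∈ H b, b ≠ a → p a x = 0
  monomial_smul_mem : ∀ (m : σ →₀ ℕ) (c : k) a, ∀ x ∈ H a,
    monomial m c • x ∈ H (Finsupp.weight w m + a)
  span_eq_top : Submodule.span (MvPolynomial σ k) (⋃ a, H a) = ⊤

namespace IsGradedFamily

variable {σ A k M : Type*} [AddCommMonoid A] [Field k] [AddCommGroup M]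
  [Module (MvPolynomial σ k) M] {w : σ → A} {H : A → Set M}

/-- By additivity it suffices to treat a monomial times a basis vector, which is homogeneous of a
single degree. One family `p` serves all homogeneous maps into `M`, so kernels of such maps are
homogeneous. -/
theorem exists_proj_comp (hH : IsGradedFamily k w H) : ∃ p : A → M →+ M,
    (∀ a, ∀ x ∈ H a, p a x = x) ∧ ∀ {n : ℕ} (deg : Fin n → A)
    (aug : (Fin n → MvPolynomial σ k) →ₗ[MvPolynomial σ k] M)
    (_ : ∀ b, aug (Pi.single b 1) ∈ H (deg b)) (a : A) (u : Fin n → MvPolynomial σ k),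
      aug (gradedPart w deg a u) = p a (aug u) := by
  classical
  obtain ⟨p, hp1, hp2⟩ := hH.exists_proj
  refine ⟨p, hp1, fun {n} deg aug haug a u => ?_⟩
  have hu : u = ∑ b, ∑ m ∈ (u b).support, Pi.single b (monomial m (coeff m (u b))) := by
    funext b
    rw [Finset.sum_apply, Finset.sum_eq_single b]
    · conv_lhs => rw [(u b).as_sum]
      simp
    · intro b' _ hb'
      simp [Pi.single_eq_of_ne (Ne.symm hb')]
    · simp
  have hadd : ∀ (s : Finset (Fin n)) (F : Fin n → Fin n → MvPolynomial σ k),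
      gradedPart w deg a (∑ i ∈ s, F i) = ∑ i ∈ s, gradedPart w deg a (F i) := fun s F =>
    map_sum (⟨⟨gradedPart w deg a, gradedPart_zero a⟩, gradedPart_add a⟩ :
      (Fin n → MvPolynomial σ k) →+ (Fin n → MvPolynomial σ k)) F s
  have hadd' : ∀ (s : Finset (σ →₀ ℕ)) (F : (σ →₀ ℕ) → Fin n → MvPolynomial σ k),
      gradedPart w deg a (∑ i ∈ s, F i) = ∑ i ∈ s, gradedPart w deg a (F i) := fun s F =>
    map_sum (⟨⟨gradedPart w deg a, gradedPart_zero a⟩, gradedPart_add a⟩ :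
      (Fin n → MvPolynomial σ k) →+ (Fin n → MvPolynomial σ k)) F s
  rw [hu]
  simp only [hadd, hadd', map_sum]
  refine Finset.sum_congr rfl fun b _ => Finset.sum_congr rfl fun m _ => ?_
  have hx := hH.monomial_smul_mem m (coeff m (u b)) _ _ (haug b)
  rw [← map_smul, ← Pi.single_smul, smul_eq_mul, mul_one] at hx
  have hv : IsHomogeneousVec w deg (Finsupp.weight w m + deg b)
      (Pi.single b (monomial m (coeff m (u b))) : Fin n → MvPolynomial σ k) := by
    intro b' m' h
    rcases eq_or_ne b' b with rfl | hb
    · rw [Pi.single_eq_same, coeff_monomial] at h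
      by_cases hm : m = m'
      · rw [hm]
      · simp [hm] at h
    · simp [Pi.single_eq_of_ne hb] at h
  by_cases ha : Finsupp.weight w m + deg b = a
  · rw [← ha, hv.gradedPart_self, hp1 _ _ hx]
  · rw [hv.gradedPart_of_ne ha, hp2 _ _ _ hx ha, map_zero]

/-- A finitely generated graded module has a free cover by homogeneous generators whose kernel is
homogeneous and contained in the submodule generated by the variables. -/
theorem exists_minimal_cover (hH : IsGradedFamily k w H) (hfin : Module.Finite (MvPolynomial σ k) M)
    (hw : ∀ (m : σ →₀ ℕ) (a : A), Finsupp.weight w m + a = a → m = 0) :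
    ∃ (n : ℕ) (deg : Fin n → A) (aug : (Fin n → MvPolynomial σ k) →ₗ[MvPolynomial σ k] M),
      (∀ b, aug (Pi.single b 1) ∈ H (deg b)) ∧ Function.Surjective aug ∧
      (∀ u, aug u = 0 → ∀ a, aug (gradedPart w deg a u) = 0) ∧
      ∀ u, aug u = 0 → ∀ b, constantCoeff (u b) = 0 := by
  classical
  obtain ⟨p, -, hp⟩ := hH.exists_proj_comp
  -- Minimality comes from choosing a homogeneous generating system with the least number of
  -- members.
  have hex : ∃ n, ∃ (x : Fin n → M) (deg : Fin n → A), (∀ j, x j ∈ H (deg j)) ∧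
      Submodule.span (MvPolynomial σ k) (Set.range x) = ⊤ := by
    have h1 := hfin.fg_top
    rw [← hH.span_eq_top, Submodule.fg_span_iff_fg_span_finset_subset] at h1
    obtain ⟨T, hT, hspan⟩ := h1
    have h2 : ∀ t : T, ∃ a, (t : M) ∈ H a := fun t => by simpa using hT t.2
    choose a ha using h2
    refine ⟨T.card, fun j => T.equivFin.symm j, fun j => a (T.equivFin.symm j),
      fun j => ha _, ?_⟩
    rw [← hH.span_eq_top, hspan]
    congr 1
    ext y
    constructor
    · rintro ⟨j, rfl⟩
      exact (T.equivFin.symm j).2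
    · intro hy
      exact ⟨T.equivFin ⟨y, hy⟩, by simp⟩
  obtain ⟨x, deg, hx, hspan⟩ := Nat.find_spec hex
  have hmin := fun m => Nat.find_min hex (m := m)
  generalize Nat.find hex = n at x deg hx hspan hmin
  have haug : ∀ b, Fintype.linearCombination (MvPolynomial σ k) x (Pi.single b 1) = x b := by
    intro b
    simp [Fintype.linearCombination_apply_single]
  have hhom : ∀ u, Fintype.linearCombination (MvPolynomial σ k) x u = 0 → ∀ a,
      Fintype.linearCombination (MvPolynomial σ k) x (gradedPart w deg a u) = 0 := by
    intro u hu a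
    rw [hp deg _ (fun b => by rw [haug]; exact hx b) a u, hu, map_zero]
  refine ⟨n, deg, Fintype.linearCombination _ x, fun b => by rw [haug]; exact hx b, ?_, hhom, ?_⟩
  · rw [← LinearMap.range_eq_top, Fintype.range_linearCombination, hspan]
  · intro u hu b
    by_contra hb
    obtain _ | n := n
    · exact b.elim0
    refine hmin n n.lt_succ_self ⟨fun j => x (b.succAbove j), fun j => deg (b.succAbove j),
      fun j => hx _, ?_⟩
    -- If a relation `u` had a nonzero constant term at `b`, its component of degree `deg b` would
    -- have at `b` a nonzero constant and nothing else, by `hw`. It would then express the generator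
    -- `x b` through the others, against the minimality of their number.
    set v := gradedPart w deg (deg b) u with hv
    have hv0 := hhom u hu (deg b)
    have hvb : v b = C (constantCoeff (u b)) := by
      ext m
      rw [hv, gradedPart, coeff_filterTerms, coeff_C]
      by_cases hm : m = 0
      · subst hm
        simp [constantCoeff_eq]
      · rw [if_neg (fun h => hm (hw m _ h)), if_neg (Ne.symm hm)]
    rw [Fintype.linearCombination_apply, Fin.sum_univ_succAbove _ b, ← hv, hvb] at hv0
    rw [eq_top_iff, ← hspan, Submodule.span_le]
    have hrest : ∀ j, x (b.succAbove j) ∈ Submodule.span (MvPolynomial σ k)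
        (Set.range fun j => x (b.succAbove j)) := fun j => Submodule.subset_span ⟨j, rfl⟩
    rintro _ ⟨j, rfl⟩
    rcases eq_or_ne j b with rfl | hj
    · have h3 : x j = (C (constantCoeff (u j))⁻¹ : MvPolynomial σ k) •
          ((C (constantCoeff (u j)) : MvPolynomial σ k) • x j) := by
        rw [smul_smul, ← C_mul, inv_mul_cancel₀ hb, C_1, one_smul]
      rw [SetLike.mem_coe, h3, eq_neg_of_add_eq_zero_left hv0]
      exact Submodule.smul_mem _ _ (Submodule.neg_mem _ (Submodule.sum_mem _ fun i _ =>
        Submodule.smul_mem _ _ (hrest i)))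
    · obtain ⟨i, rfl⟩ := Fin.exists_succAbove_eq hj
      exact hrest i

end IsGradedFamily

/-- A free module with a homogeneous submodule contained in the submodule generated by the
variables, to be resolved further. -/
structure GradedSyzygy {σ A : Type*} (k : Type*) [AddCommMonoid A] [Field k] (w : σ → A) where
  /-- The rank of the free module. -/
  rank : ℕ
  /-- The degrees of the basis. -/
  deg : Fin rank → A
  /-- The submodule. -/
  carrier : Submodule (MvPolynomial σ k) (Fin rank → MvPolynomial σ k)
  gradedPart_mem : ∀ u ∈ carrier, ∀ a, gradedPart w deg a u ∈ carrier
  constantCoeff_eq_zero : ∀ u ∈ carrier, ∀ b, constantCoeff (u b) = 0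

namespace GradedSyzygy

variable {σ A k : Type*} [AddCommMonoid A] [Field k] {w : σ → A}

theorem isGradedFamily (K : GradedSyzygy k w) :
    IsGradedFamily k w fun a => {u : K.carrier | IsHomogeneousVec w K.deg a u.1} where
  exists_proj := by
    refine ⟨fun a => ⟨⟨fun u => ⟨gradedPart w K.deg a u.1, K.gradedPart_mem _ u.2 a⟩, ?_⟩, ?_⟩,
      ?_, ?_⟩
    · exact Subtype.ext (gradedPart_zero (w := w) (deg := K.deg) a)
    · exact fun u v => Subtype.ext (gradedPart_add a _ _)
    · exact fun a x hx => Subtype.ext hx.gradedPart_self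
    · exact fun a b x hx hne => Subtype.ext (hx.gradedPart_of_ne hne)
  monomial_smul_mem := by
    classical
    intro m c a x hx b m' h
    change coeff m' (monomial m c * x.1 b) ≠ 0 at h
    rw [coeff_monomial_mul'] at h
    split_ifs at h with hm
    · rw [← hx b (m' - m) (right_ne_zero_of_mul h), ← add_assoc, ← map_add,
        add_tsub_cancel_of_le hm]
    · exact absurd rfl h
  span_eq_top := by
    refine eq_top_iff.2 fun u _ => ?_
    obtain ⟨T, hT⟩ := exists_sum_gradedPart w K.deg u.1
    have : u = ∑ a ∈ T, ⟨gradedPart w K.deg a u.1, K.gradedPart_mem _ u.2 a⟩ :=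
      Subtype.ext (by rw [AddSubmonoidClass.coe_finsetSum]; exact hT)
    rw [this]
    exact Submodule.sum_mem _ fun a _ => Submodule.subset_span
      (Set.mem_iUnion.2 ⟨a, isHomogeneousVec_gradedPart a _⟩)

/-- One step of the construction: the kernel of a minimal cover of a syzygy module again satisfies
the conditions of `GradedSyzygy`, so the step can be iterated. -/
theorem exists_next [Finite σ] (hw : ∀ (m : σ →₀ ℕ) (a : A), Finsupp.weight w m + a = a → m = 0)
    (K : GradedSyzygy k w) : ∃ (K' : GradedSyzygy k w)
      (D : Matrix (Fin K.rank) (Fin K'.rank) (MvPolynomial σ k)),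
      IsHomogeneousMatrix w K.deg K'.deg D ∧ LinearMap.range D.mulVecLin = K.carrier ∧
        LinearMap.ker D.mulVecLin = K'.carrier := by
  obtain ⟨n, deg, aug, h1, h2, h3, h4⟩ := K.isGradedFamily.exists_minimal_cover inferInstance hw
  have hlin : (LinearMap.toMatrix' (K.carrier.subtype ∘ₗ aug)).mulVecLin =
      K.carrier.subtype ∘ₗ aug := by
    rw [← Matrix.toLin'_apply', Matrix.toLin'_toMatrix']
  have hker : LinearMap.ker (K.carrier.subtype ∘ₗ aug) = LinearMap.ker aug :=
    LinearMap.ker_comp_of_ker_eq_bot _ (Submodule.ker_subtype _)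
  refine ⟨⟨n, deg, LinearMap.ker aug, fun u hu a => h3 u hu a, fun u hu b => h4 u hu b⟩,
    LinearMap.toMatrix' (K.carrier.subtype ∘ₗ aug), ?_, ?_, ?_⟩
  · intro b c m hm
    rw [LinearMap.toMatrix'_apply] at hm
    exact h1 c b m hm
  · rw [hlin, LinearMap.range_comp, LinearMap.range_eq_top.2 h2, Submodule.map_top,
      Submodule.range_subtype]
  · rw [hlin, hker]

end GradedSyzygy

section Existence

variable {σ A k M : Type*} [AddCommMonoid A] [Field k] [AddCommGroup M] [Module k M]
  [Module (MvPolynomial σ k) M] {w : σ → A} {𝓜 : A → Submodule k M}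

/-- Existence of minimal graded free resolutions. -/
theorem IsGradedFamily.nonempty_minimalGradedFreeResolution [Finite σ]
    (h : IsGradedFamily k w fun a => (𝓜 a : Set M)) (hfin : Module.Finite (MvPolynomial σ k) M)
    (hw : ∀ (m : σ →₀ ℕ) (a : A), Finsupp.weight w m + a = a → m = 0) :
    Nonempty (MinimalGradedFreeResolution w 𝓜) := by
  obtain ⟨n, deg, aug, h1, h2, h3, h4⟩ := h.exists_minimal_cover hfin hw
  choose next D hhom hrange hker using GradedSyzygy.exists_next (k := k) hw
  let K : ℕ → GradedSyzygy k w := fun i =>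
    Nat.rec ⟨n, deg, LinearMap.ker aug, fun u hu a => h3 u hu a, fun u hu b => h4 u hu b⟩
      (fun _ => next) i
  exact ⟨{
    rank := fun i => (K i).rank
    deg := fun i => (K i).deg
    d := fun i => D (K i)
    aug := aug
    aug_mem := h1
    d_homogeneous := fun i => hhom (K i)
    aug_surjective := h2
    exact_zero := LinearMap.exact_iff.2 (hrange (K 0)).symm
    exact_succ := fun i => LinearMap.exact_iff.2 ((hker (K i)).trans (hrange (K (i + 1))).symm)
    -- Each column of the differential lies in the syzygy module that it covers, whose elements have
    -- entries without constant term.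
    minimal := fun i b c => (K i).constantCoeff_eq_zero ((D (K i)).col c) (by
      rw [← hrange (K i)]
      exact ⟨Pi.single c 1, by simp⟩) b }⟩

end Existence

/-! ### Comparison of resolutions and uniqueness of Betti numbers -/

/-- Dependent choice in a family of types: `P` is the invariant that permits the next choice, `Q`
the relation to be kept between neighbours. -/
theorem exists_dependent_seq {X : ℕ → Type*} {P : ∀ i, X i → Prop}
    {Q : ∀ i, X i → X (i + 1) → Prop} (x0 : X 0) (hx0 : P 0 x0)
    (hs : ∀ i x, P i x → ∃ y, P (i + 1) y ∧ Q i x y) :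
    ∃ x : ∀ i, X i, x 0 = x0 ∧ (∀ i, P i (x i)) ∧ ∀ i, Q i (x i) (x (i + 1)) := by
  choose f hf using hs
  let x : ∀ i, {x : X i // P i x} := fun i =>
    Nat.rec ⟨x0, hx0⟩ (fun i x => ⟨f i x.1 x.2, (hf i x.1 x.2).1⟩) i
  exact ⟨fun i => (x i).1, rfl, fun i => (x i).2, fun i => (hf i (x i).1 (x i).2).2⟩

namespace MinimalGradedFreeResolution

variable {σ A k M : Type*} [AddCommMonoid A] [Field k] [AddCommGroup M] [Module k M]
  [Module (MvPolynomial σ k) M] {w : σ → A} {𝓜 : A → Submodule k M}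

theorem isHomogeneousMatrix (F : MinimalGradedFreeResolution w 𝓜) (i : ℕ) :
    IsHomogeneousMatrix w (F.deg i) (F.deg (i + 1)) (F.d i) :=
  F.d_homogeneous i

theorem mem_range_iff (F : MinimalGradedFreeResolution w 𝓜) (i : ℕ)
    (v : Fin (F.rank (i + 1)) → MvPolynomial σ k) :
    (∃ u, (F.d (i + 1)).mulVec u = v) ↔ (F.d i).mulVec v = 0 :=
  (F.exact_succ i v).symm

theorem mem_range_zero_iff (F : MinimalGradedFreeResolution w 𝓜)
    (v : Fin (F.rank 0) → MvPolynomial σ k) :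
    (∃ u, (F.d 0).mulVec u = v) ↔ F.aug v = 0 :=
  (F.exact_zero v).symm

theorem d_mul_d (F : MinimalGradedFreeResolution w 𝓜) (i : ℕ) : F.d i * F.d (i + 1) = 0 := by
  refine Matrix.toLin'.injective (LinearMap.ext fun v => ?_)
  rw [Matrix.toLin'_apply, ← Matrix.mulVec_mulVec, map_zero, LinearMap.zero_apply]
  exact (F.mem_range_iff i _).1 ⟨v, rfl⟩

/-- The identity of `M` lifts to a homogeneous map of complexes. -/
theorem exists_comparison (h : IsGradedFamily k w fun a => (𝓜 a : Set M))
    (F G : MinimalGradedFreeResolution w 𝓜) :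
    ∃ α : ∀ i, Matrix (Fin (G.rank i)) (Fin (F.rank i)) (MvPolynomial σ k),
      (∀ i, IsHomogeneousMatrix w (G.deg i) (F.deg i) (α i)) ∧
      (∀ v, G.aug ((α 0).mulVec v) = F.aug v) ∧ ∀ i, G.d i * α (i + 1) = α i * F.d i := by
  obtain ⟨p, hp1, hp⟩ := h.exists_proj_comp
  have h0 : ∃ α : Matrix (Fin (G.rank 0)) (Fin (F.rank 0)) (MvPolynomial σ k),
      IsHomogeneousMatrix w (G.deg 0) (F.deg 0) α ∧ ∀ v, G.aug (α.mulVec v) = F.aug v := by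
    have hex : ∀ b, ∃ u, IsHomogeneousVec w (G.deg 0) (F.deg 0 b) u ∧
        G.aug u = F.aug (Pi.single b 1) := by
      intro b
      obtain ⟨u, hu⟩ := G.aug_surjective (F.aug (Pi.single b 1))
      refine ⟨gradedPart w (G.deg 0) (F.deg 0 b) u, isHomogeneousVec_gradedPart _ _, ?_⟩
      rw [hp _ _ G.aug_mem, hu, hp1 _ _ (F.aug_mem b)]
    choose u hu hu' using hex
    refine ⟨Matrix.of fun i b => u b i, fun b c m hm => hu c b m hm, fun v => ?_⟩
    have : G.aug ∘ₗ (Matrix.of fun i b => u b i).mulVecLin = F.aug := by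
      refine LinearMap.pi_ext' fun b => LinearMap.ext_ring ?_
      simp only [LinearMap.comp_apply, LinearMap.coe_single, Matrix.mulVecLin_apply,
        Matrix.mulVec_single_one]
      exact hu' b
    exact LinearMap.congr_fun this v
  obtain ⟨α0, hα0, hα0'⟩ := h0
  -- The invariant says that `α i` carries the image of `F.d i` into the image of `G.d i`. This is
  -- what is needed to lift column by column, and it treats `i = 0`, where exactness involves `aug`,
  -- uniformly with the rest.
  obtain ⟨α, h0, hα, hc⟩ := exists_dependent_seq
    (X := fun i => Matrix (Fin (G.rank i)) (Fin (F.rank i)) (MvPolynomial σ k))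
    (P := fun i α => IsHomogeneousMatrix w (G.deg i) (F.deg i) α ∧
      ∀ v, ∃ u, (G.d i).mulVec u = α.mulVec ((F.d i).mulVec v))
    (Q := fun i α α' => G.d i * α' = α * F.d i) α0 ⟨hα0, fun v => by
      rw [G.mem_range_zero_iff, hα0', ← F.mem_range_zero_iff]
      exact ⟨v, rfl⟩⟩ (by
      rintro i α ⟨hα, hr⟩
      have hex : ∀ b, ∃ u, IsHomogeneousVec w (G.deg (i + 1)) (F.deg (i + 1) b) u ∧
          (G.d i).mulVec u = (α * F.d i).col b := by
        intro b
        refine (G.isHomogeneousMatrix i).exists_mulVec_eq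
          ((hα.mul (F.isHomogeneousMatrix i)).isHomogeneousVec_col b) ?_
        obtain ⟨u, hu⟩ := hr (Pi.single b 1)
        exact ⟨u, by rw [hu, Matrix.mulVec_mulVec, Matrix.mulVec_single_one]⟩
      choose u hu hu' using hex
      have hcomm : G.d i * (Matrix.of fun j b => u b j) = α * F.d i := by
        ext1 j b
        exact congrFun (hu' b) j
      refine ⟨Matrix.of fun j b => u b j, ⟨fun b c m hm => hu c b m hm, fun v => ?_⟩, hcomm⟩
      rw [G.mem_range_iff, Matrix.mulVec_mulVec, hcomm, ← Matrix.mulVec_mulVec,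
        (F.mem_range_iff i _).1 ⟨v, rfl⟩, Matrix.mulVec_zero])
  exact ⟨α, fun i => (hα i).1, h0 ▸ hα0', hc⟩

/-- An endomorphism of a minimal resolution that lifts zero has entries without constant term. -/
theorem constantCoeff_eq_zero_of_lift_zero (F : MinimalGradedFreeResolution w 𝓜)
    (γ : ∀ i, Matrix (Fin (F.rank i)) (Fin (F.rank i)) (MvPolynomial σ k))
    (h0 : ∀ v, F.aug ((γ 0).mulVec v) = 0) (hγ : ∀ i, F.d i * γ (i + 1) = γ i * F.d i)
    (i : ℕ) : (γ i).map constantCoeff = 0 := by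
  have hd : ∀ i, (F.d i).map constantCoeff = 0 := fun i => Matrix.ext (F.minimal i)
  -- This is a null-homotopy built degree by degree: `g` stands for the term coming from homological
  -- degree `i - 1`, which is zero for `i = 0` and `s * F.d i` in degree `i + 1`. Both summands of
  -- `γ i` contain a differential as a factor, so they vanish modulo the variables.
  have key : ∀ i, ∃ (s : Matrix (Fin (F.rank (i + 1))) (Fin (F.rank i)) (MvPolynomial σ k))
      (g : Matrix (Fin (F.rank i)) (Fin (F.rank i)) (MvPolynomial σ k)),
      γ i = F.d i * s + g ∧ g.map constantCoeff = 0 ∧ g * F.d i = 0 := by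
    intro i
    induction i with
    | zero =>
      have hex : ∀ b, ∃ u, (F.d 0).mulVec u = (γ 0).col b := fun b => by
        rw [F.mem_range_zero_iff, ← Matrix.mulVec_single_one]
        exact h0 _
      choose s hs using hex
      refine ⟨Matrix.of fun j b => s b j, 0, ?_, by simp, by simp⟩
      rw [add_zero]
      ext1 j b
      exact (congrFun (hs b) j).symm
    | succ i ih =>
      obtain ⟨s, g, h1, h2, h3⟩ := ih
      have hzero : F.d i * (γ (i + 1) - s * F.d i) = 0 := by
        rw [Matrix.mul_sub, hγ, h1, Matrix.add_mul, h3, add_zero, Matrix.mul_assoc, sub_self]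
      have hex : ∀ b, ∃ u, (F.d (i + 1)).mulVec u = (γ (i + 1) - s * F.d i).col b := fun b => by
        rw [F.mem_range_iff, ← Matrix.mulVec_single_one, Matrix.mulVec_mulVec, hzero,
          Matrix.zero_mulVec]
      choose t ht using hex
      refine ⟨Matrix.of fun j b => t b j, s * F.d i, ?_, ?_, ?_⟩
      · rw [← sub_eq_iff_eq_add]
        ext1 j b
        exact (congrFun (ht b) j).symm
      · rw [Matrix.map_mul, hd, Matrix.mul_zero]
      · rw [Matrix.mul_assoc, F.d_mul_d, Matrix.mul_zero]
  obtain ⟨s, g, h1, h2, -⟩ := key i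
  rw [h1, Matrix.map_add _ (map_add _), Matrix.map_mul, hd, h2, Matrix.zero_mul, add_zero]

/-- The composite `β α` and the identity both lift the identity of `M`, so their difference lifts
zero and dies modulo the variables. -/
theorem map_constantCoeff_mul_eq_one (F G : MinimalGradedFreeResolution w 𝓜)
    {α : ∀ i, Matrix (Fin (G.rank i)) (Fin (F.rank i)) (MvPolynomial σ k)}
    {β : ∀ i, Matrix (Fin (F.rank i)) (Fin (G.rank i)) (MvPolynomial σ k)}
    (hα0 : ∀ v, G.aug ((α 0).mulVec v) = F.aug v) (hα : ∀ i, G.d i * α (i + 1) = α i * F.d i)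
    (hβ0 : ∀ v, F.aug ((β 0).mulVec v) = G.aug v) (hβ : ∀ i, F.d i * β (i + 1) = β i * G.d i)
    (i : ℕ) : (β i).map constantCoeff * (α i).map constantCoeff = 1 := by
  have := F.constantCoeff_eq_zero_of_lift_zero (fun i => β i * α i - 1)
    (fun v => by rw [Matrix.sub_mulVec, Matrix.one_mulVec, map_sub, ← Matrix.mulVec_mulVec, hβ0,
      hα0, sub_self])
    (fun i => by rw [Matrix.mul_sub, ← Matrix.mul_assoc, hβ, Matrix.mul_assoc, hα, Matrix.sub_mul,
      Matrix.mul_assoc, Matrix.mul_one, Matrix.one_mul]) i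
  rwa [Matrix.map_sub _ (map_sub _), Matrix.map_mul, Matrix.map_one _ (map_zero _) (map_one _),
    sub_eq_zero] at this

/-- Uniqueness of graded Betti numbers. -/
theorem betti_eq (h : IsGradedFamily k w fun a => (𝓜 a : Set M))
    (F G : MinimalGradedFreeResolution w 𝓜) (i : ℕ) (a : A) : F.betti i a = G.betti i a := by
  classical
  obtain ⟨α, hαh, hα0, hα⟩ := exists_comparison h F G
  obtain ⟨β, hβh, hβ0, hβ⟩ := exists_comparison h G F
  have hβα := map_constantCoeff_mul_eq_one F G hα0 hα hβ0 hβ i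
  have hαβ := map_constantCoeff_mul_eq_one G F hβ0 hβ hα0 hα i
  -- Modulo the variables a homogeneous matrix has nonzero entries only between basis elements of
  -- equal degree. The inverse matrices `α` and `β` therefore split into inverse blocks, one for
  -- each degree, and invertible blocks are square.
  have hdeg : ∀ {n n' : ℕ} {deg : Fin n → A} {deg' : Fin n' → A}
      {D : Matrix (Fin n) (Fin n') (MvPolynomial σ k)}, IsHomogeneousMatrix w deg deg' D →
      ∀ b c, D.map constantCoeff b c ≠ 0 → deg b = deg' c := by
    intro n n' deg deg' D hD b c hbc
    simpa using hD b c 0 hbc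
  have hblock : ∀ {n n' : ℕ} {deg : Fin n → A} {deg' : Fin n' → A}
      {D : Matrix (Fin n) (Fin n') (MvPolynomial σ k)} {E : Matrix (Fin n') (Fin n)
        (MvPolynomial σ k)}, IsHomogeneousMatrix w deg deg' D →
      D.map constantCoeff * E.map constantCoeff = 1 →
      (D.map constantCoeff).submatrix (Subtype.val : {b // deg b = a} → Fin n)
        (Subtype.val : {b // deg' b = a} → Fin n') *
      (E.map constantCoeff).submatrix (Subtype.val : {b // deg' b = a} → Fin n')
        (Subtype.val : {b // deg b = a} → Fin n) = 1 := by
    intro n n' deg deg' D E hD h1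
    ext b c
    have h2 := congrFun (congrFun h1 b) c
    rw [Matrix.mul_apply] at h2 ⊢
    simp only [Matrix.submatrix_apply]
    have h3 : ∑ x : {b // deg' b = a}, D.map constantCoeff b x * E.map constantCoeff x c =
        ∑ x, D.map constantCoeff b x * E.map constantCoeff x c := by
      rw [← Finset.sum_filter_of_ne (p := fun x => deg' x = a)]
      · exact (Finset.sum_subtype (Finset.univ.filter fun x => deg' x = a) (fun x => by simp)
          fun x => D.map constantCoeff b x * E.map constantCoeff x c).symm
      · intro x _ hx
        rw [← hdeg hD b x (left_ne_zero_of_mul hx), b.2]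
    rw [h3, h2, Matrix.one_apply, Matrix.one_apply]
    simp [Subtype.ext_iff]
  have := Matrix.square_of_invertible _ _ (hblock (hβh i) hβα) (hblock (hαh i) hαβ)
  rw [betti, betti, Nat.card_eq_fintype_card, Nat.card_eq_fintype_card]
  exact this

end MinimalGradedFreeResolution

/-! ### Coordinates along a basis of a free algebra -/

section Coordinates

variable {S R Λ : Type*} [CommRing S] [CommRing R] [Algebra S R] (bas : Module.Basis Λ S R)

/-- The extended ideal is `I • R`, and in a free module this is the direct sum of the copies of `I`
along the basis. -/
theorem Module.Basis.mem_ideal_map_iff {I : Ideal S} {z : R} :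
    z ∈ I.map (algebraMap S R) ↔ ∀ l, bas.repr z l ∈ I := by
  constructor
  · intro hz l
    have hz' : z ∈ I • (⊤ : Submodule S R) := by rwa [Ideal.smul_top_eq_map]
    refine Submodule.smul_induction_on (p := fun z => bas.repr z l ∈ I) hz' ?_ ?_
    · intro x hx r _
      rw [map_smul, Finsupp.smul_apply, smul_eq_mul]
      exact I.mul_mem_right _ hx
    · intro x y hx hy
      rw [map_add, Finsupp.add_apply]
      exact I.add_mem hx hy
  · intro h
    rw [← bas.linearCombination_repr z, Finsupp.linearCombination_apply]
    refine Submodule.sum_mem _ fun l _ => ?_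
    change bas.repr z l • bas l ∈ _
    rw [Algebra.smul_def]
    exact Ideal.mul_mem_right _ _ (Ideal.mem_map_of_mem _ (h l))

/-- The vector of the `l`-th coordinates of a vector with respect to a basis. -/
noncomputable def Module.Basis.coordVec {ι : Type*} (u : ι → R) (l : Λ) : ι → S :=
  fun j => bas.repr (u j) l

theorem Module.Basis.repr_sum_mul_algebraMap {ι : Type*} [Fintype ι] (t : ι → S) (u : ι → R)
    (l : Λ) : bas.repr (∑ j, u j * algebraMap S R (t j)) l = ∑ j, bas.coordVec u l j * t j := by
  rw [map_sum, Finsupp.finsetSum_apply]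
  refine Finset.sum_congr rfl fun j _ => ?_
  rw [mul_comm, ← Algebra.smul_def, map_smul, Finsupp.smul_apply, smul_eq_mul, mul_comm]
  rfl

theorem Module.Basis.coordVec_mulVec {ι κ : Type*} [Fintype κ] (D : Matrix ι κ S) (u : κ → R)
    (l : Λ) : bas.coordVec ((D.map (algebraMap S R)).mulVec u) l = D.mulVec (bas.coordVec u l) := by
  funext i
  simp only [Module.Basis.coordVec, Matrix.mulVec, dotProduct, Matrix.map_apply, map_sum,
    Finsupp.finsetSum_apply, ← Algebra.smul_def, map_smul, Finsupp.smul_apply, smul_eq_mul]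

theorem Module.Basis.ext_coordVec {ι : Type*} {u v : ι → R}
    (h : ∀ l, bas.coordVec u l = bas.coordVec v l) : u = v :=
  funext fun i => bas.ext_elem fun l => congrFun (h l) i

theorem Module.Basis.exists_coordVec_eq {ι : Type*} [Finite ι] {v : Λ → ι → S}
    {T : Set Λ} (hT : T.Finite) (hv : ∀ l, l ∉ T → v l = 0) :
    ∃ u : ι → R, ∀ l, bas.coordVec u l = v l := by
  have hfin : ∀ j, (Function.support fun l => v l j).Finite := fun j =>
    hT.subset fun l hl => by
      by_contra h
      exact hl (congrFun (hv l h) j)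
  refine ⟨fun j => bas.repr.symm (Finsupp.ofSupportFinite (fun l => v l j) (hfin j)), fun l => ?_⟩
  funext j
  simp only [Module.Basis.coordVec, LinearEquiv.apply_symm_apply]
  rfl

/-- Solving a condition on the coordinates of a vector, one coordinate at a time. -/
theorem Module.Basis.exists_forall_coordVec {ι : Type*} [Finite ι] {P : Λ → (ι → S) → Prop}
    (hP : ∀ l, ∃ v, P l v) {T : Set Λ} (hT : T.Finite) (hP0 : ∀ l, l ∉ T → P l 0) :
    ∃ u : ι → R, ∀ l, P l (bas.coordVec u l) := by
  classical
  choose v hv using hP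
  obtain ⟨u, hu⟩ := bas.exists_coordVec_eq (v := fun l => if l ∈ T then v l else 0) hT
    (fun l hl => if_neg hl)
  refine ⟨u, fun l => ?_⟩
  rw [hu]
  split_ifs with h
  · exact hv l
  · exact hP0 l h

theorem Module.Basis.finite_setOf_coordVec_ne_zero {ι : Type*} [Finite ι] (u : ι → R) :
    {l | bas.coordVec u l ≠ 0}.Finite := by
  refine (Set.finite_iUnion fun j => (bas.repr (u j)).hasFiniteSupport).subset fun l hl => ?_
  obtain ⟨j, hj⟩ := Function.ne_iff.1 hl
  exact Set.mem_iUnion.2 ⟨j, hj⟩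

/-- A matrix over `S` acts on each coordinate vector separately, so exactness is inherited
coordinatewise. The basis may be infinite; zero is chosen as preimage wherever the coordinate of `v`
is zero, so that the preimages assemble to a vector over `R`. -/
theorem Module.Basis.exact_map_algebraMap (bas : Module.Basis Λ S R) {ι κ μ : Type*}
    [Finite ι] [Fintype κ] [Fintype μ]
    {D : Matrix ι κ S} {E : Matrix κ μ S} (h : Function.Exact E.mulVecLin D.mulVecLin) :
    Function.Exact (E.map (algebraMap S R)).mulVecLin (D.map (algebraMap S R)).mulVecLin := by
  intro v
  have h1 : (D.map (algebraMap S R)).mulVecLin v = 0 ↔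
      ∀ l, ∃ u, E.mulVec u = bas.coordVec v l := by
    have : ∀ l, (∃ u, E.mulVec u = bas.coordVec v l) ↔
        bas.coordVec ((D.map (algebraMap S R)).mulVec v) l = 0 := fun l => by
      rw [bas.coordVec_mulVec]
      exact (h _).symm
    simp only [this]
    constructor
    · intro h0 l
      rw [Matrix.mulVecLin_apply] at h0
      rw [h0]
      funext i
      simp [Module.Basis.coordVec]
    · intro h0
      refine bas.ext_coordVec fun l => ?_
      rw [Matrix.mulVecLin_apply, h0 l]
      funext i
      simp [Module.Basis.coordVec]
  rw [h1]
  constructor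
  · intro hex
    obtain ⟨u, hu⟩ := bas.exists_forall_coordVec hex (bas.finite_setOf_coordVec_ne_zero v)
      (fun l hl => by rw [Matrix.mulVec_zero, not_not.1 hl])
    exact ⟨u, bas.ext_coordVec fun l => by rw [Matrix.mulVecLin_apply, bas.coordVec_mulVec, hu]⟩
  · rintro ⟨u, rfl⟩ l
    exact ⟨bas.coordVec u l, by rw [Matrix.mulVecLin_apply, bas.coordVec_mulVec]⟩

end Coordinates

/-! ### Gradings of homogeneous ideals and their quotients -/

section Grading

variable {σ A k : Type*} [AddCommMonoid A] [Field k] {w : σ → A} {I : Ideal (MvPolynomial σ k)}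

theorem MvPolynomial.exists_sum_weightedHomogeneousComponent (w : σ → A) (p : MvPolynomial σ k) :
    ∃ T : Finset A, p = ∑ a ∈ T, weightedHomogeneousComponent w a p := by
  refine ⟨(weightedHomogeneousComponent_finsupp (w := w) p).toFinset, ?_⟩
  conv_lhs => rw [← sum_weightedHomogeneousComponent w p]
  exact finsum_eq_sum _ _

theorem MvPolynomial.IsWeightedHomogeneous.monomial_mul {p : MvPolynomial σ k} {a : A}
    (hp : IsWeightedHomogeneous w p a) (m : σ →₀ ℕ) (c : k) :
    IsWeightedHomogeneous w (monomial m c * p) (Finsupp.weight w m + a) :=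
  (isWeightedHomogeneous_monomial w m c rfl).mul hp

theorem isGradedFamily_idealGrading (hI : ∀ p ∈ I, ∀ a, weightedHomogeneousComponent w a p ∈ I) :
    IsGradedFamily k w fun a => (idealGrading w I a : Set I) where
  exists_proj := by
    refine ⟨fun a => ⟨⟨fun x => ⟨weightedHomogeneousComponent w a x.1, hI _ x.2 a⟩, ?_⟩, ?_⟩,
      ?_, ?_⟩
    · exact Subtype.ext (map_zero _)
    · exact fun x y => Subtype.ext (map_add _ _ _)
    · exact fun a x hx => Subtype.ext (IsWeightedHomogeneous.weightedHomogeneousComponent_same hx)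
    · exact fun a b x hx hne =>
        Subtype.ext (IsWeightedHomogeneous.weightedHomogeneousComponent_ne a hx hne.symm)
  monomial_smul_mem := fun m c a x hx => IsWeightedHomogeneous.monomial_mul hx m c
  span_eq_top := by
    refine eq_top_iff.2 fun x _ => ?_
    obtain ⟨T, hT⟩ := exists_sum_weightedHomogeneousComponent w x.1
    have : x = ∑ a ∈ T, ⟨weightedHomogeneousComponent w a x.1, hI _ x.2 a⟩ :=
      Subtype.ext (by rw [AddSubmonoidClass.coe_finsetSum]; exact hT)
    rw [this]
    exact Submodule.sum_mem _ fun a _ => Submodule.subset_span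
      (Set.mem_iUnion.2 ⟨a, weightedHomogeneousComponent_isWeightedHomogeneous _ _⟩)

theorem isGradedFamily_quotientGrading
    (hI : ∀ p ∈ I, ∀ a, weightedHomogeneousComponent w a p ∈ I) :
    IsGradedFamily k w fun a => (quotientGrading w I a : Set (MvPolynomial σ k ⧸ I)) where
  exists_proj := by
    have key : ∀ a (p q : MvPolynomial σ k), Ideal.Quotient.mk I p = Ideal.Quotient.mk I q →
        Ideal.Quotient.mk I (weightedHomogeneousComponent w a p) =
          Ideal.Quotient.mk I (weightedHomogeneousComponent w a q) := by
      intro a p q h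
      rw [Ideal.Quotient.eq] at h ⊢
      rw [← map_sub]
      exact hI _ h a
    -- The section `s` is merely set-theoretic; `key` shows that the resulting projection does not
    -- depend on it, which gives additivity.
    choose s hs using Ideal.Quotient.mk_surjective (I := I)
    have key' : ∀ a p, Ideal.Quotient.mk I (weightedHomogeneousComponent w a
        (s (Ideal.Quotient.mk I p))) = Ideal.Quotient.mk I (weightedHomogeneousComponent w a p) :=
      fun a p => key a _ _ (hs _)
    refine ⟨fun a => ⟨⟨fun x => Ideal.Quotient.mk I (weightedHomogeneousComponent w a (s x)), ?_⟩,
      ?_⟩, ?_, ?_⟩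
    · rw [← map_zero (Ideal.Quotient.mk I), key', map_zero]
    · intro x y
      change Ideal.Quotient.mk I _ = Ideal.Quotient.mk I _ + Ideal.Quotient.mk I _
      rw [← map_add, ← map_add]
      exact key a _ _ (by rw [map_add, hs, hs, hs])
    · rintro a _ ⟨p, hp, rfl⟩
      refine (key' a p).trans ?_
      rw [IsWeightedHomogeneous.weightedHomogeneousComponent_same hp]
      rfl
    · rintro a b _ ⟨p, hp, rfl⟩ hne
      refine (key' a p).trans ?_
      rw [IsWeightedHomogeneous.weightedHomogeneousComponent_ne a hp hne.symm, map_zero]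
  monomial_smul_mem := by
    rintro m c a _ ⟨p, hp, rfl⟩
    exact ⟨_, IsWeightedHomogeneous.monomial_mul hp m c, rfl⟩
  span_eq_top := by
    refine eq_top_iff.2 fun x _ => ?_
    obtain ⟨p, rfl⟩ := Ideal.Quotient.mk_surjective x
    have : Ideal.Quotient.mk I p = p • (Ideal.Quotient.mk I 1) := by
      rw [← Ideal.Quotient.mk_eq_mk, ← Ideal.Quotient.mk_eq_mk, ← Submodule.Quotient.mk_smul,
        smul_eq_mul, mul_one]
    rw [this]
    exact Submodule.smul_mem _ _ (Submodule.subset_span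
      (Set.mem_iUnion.2 ⟨0, 1, isWeightedHomogeneous_one k w, rfl⟩))

end Grading

/-! ### Base change of resolutions and regrading of Betti numbers -/

/-- The left side counts the basis after base change, when degrees have been pushed along `φ`. Only
finitely many degrees occur, so the `finsum` in `regradeBetti` is a genuine sum over the fibre. -/
theorem MinimalGradedFreeResolution.card_eq_regradeBetti {σ A B k M : Type*} [AddCommMonoid A]
    [Field k] [AddCommGroup M] [Module k M] [Module (MvPolynomial σ k) M]
    {w : σ → A} {𝓜 : A → Submodule k M} (F : MinimalGradedFreeResolution w 𝓜) (φ : A → B)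
    (i : ℕ) (b : B) :
    Nat.card {x : Fin (F.rank i) // φ (F.deg i x) = b} = regradeBetti φ F.betti i b := by
  classical
  have hb : ∀ a, F.betti i a = (Finset.univ.filter fun x => F.deg i x = a).card := fun a => by
    rw [MinimalGradedFreeResolution.betti, Nat.card_eq_fintype_card, Fintype.card_subtype]
  rw [regradeBetti, finsum_mem_eq_sum_of_inter_support_eq (t :=
    (Finset.univ.image (F.deg i)).filter fun a => φ a = b), Nat.card_eq_fintype_card,
    Fintype.card_subtype, Finset.card_eq_sum_card_fiberwise (f := F.deg i)
      (t := (Finset.univ.image (F.deg i)).filter fun a => φ a = b)]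
  · refine Finset.sum_congr rfl fun a ha => ?_
    rw [hb, Finset.filter_filter]
    congr 1
    ext x
    simp only [Finset.mem_filter, Finset.mem_univ, true_and, and_iff_right_iff_imp]
    rintro rfl
    exact (Finset.mem_filter.1 ha).2
  · intro x hx
    simpa using hx
  · ext a
    simp only [Set.mem_inter_iff, Set.mem_ofPred_eq, Function.mem_support, Finset.coe_filter,
      Finset.mem_image, Finset.mem_univ, true_and, hb]
    constructor
    · rintro ⟨h1, h2⟩
      obtain ⟨x, hx⟩ := Finset.card_ne_zero.1 h2
      exact ⟨⟨⟨x, (Finset.mem_filter.1 hx).2⟩, h1⟩, h2⟩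
    · rintro ⟨⟨-, h1⟩, h2⟩
      exact ⟨h1, h2⟩

section HomogeneousAlgebraMap

variable {σ τ A B k : Type*} [AddCommMonoid A] [AddCommMonoid B] [Field k]
  [Algebra (MvPolynomial σ k) (MvPolynomial τ k)]

/-- The algebra structure sends the variables to homogeneous polynomials without constant term,
whose degrees are given by `φ`. -/
structure IsHomogeneousAlgebra (k : Type*) [Field k]
    [Algebra (MvPolynomial σ k) (MvPolynomial τ k)] (w : σ → A) (w' : τ → B) (φ : A →+ B) :
    Prop where
  map_C : ∀ c : k, algebraMap (MvPolynomial σ k) (MvPolynomial τ k) (C c) = C c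
  map_X : ∀ i, IsWeightedHomogeneous w' (algebraMap (MvPolynomial σ k) (MvPolynomial τ k) (X i))
    (φ (w i))
  constantCoeff_map_X : ∀ i,
    constantCoeff (algebraMap (MvPolynomial σ k) (MvPolynomial τ k) (X i)) = 0

variable {w : σ → A} {w' : τ → B} {φ : A →+ B}

namespace IsHomogeneousAlgebra

theorem map_monomial (h : IsHomogeneousAlgebra k w w' φ) (m : σ →₀ ℕ) (c : k) :
    IsWeightedHomogeneous w' (algebraMap (MvPolynomial σ k) (MvPolynomial τ k) (monomial m c))
      (φ (Finsupp.weight w m)) := by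
  rw [monomial_eq, map_mul, h.map_C, Finsupp.prod, map_prod]
  have h1 := (isWeightedHomogeneous_C w' c).mul (IsWeightedHomogeneous.prod m.support
    (fun i => algebraMap (MvPolynomial σ k) (MvPolynomial τ k) (X i ^ m i))
    (fun i => m i • φ (w i)) (fun i _ => by rw [map_pow]; exact (h.map_X i).pow _))
  rw [zero_add] at h1
  rw [Finsupp.weight_apply, Finsupp.sum, map_sum]
  simpa only [map_nsmul] using h1

theorem exists_coeff_ne_zero (h : IsHomogeneousAlgebra k w w' φ) (p : MvPolynomial σ k)
    {m : τ →₀ ℕ} (hm : coeff m (algebraMap (MvPolynomial σ k) (MvPolynomial τ k) p) ≠ 0) :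
    ∃ m', coeff m' p ≠ 0 ∧ Finsupp.weight w' m = φ (Finsupp.weight w m') := by
  rw [p.as_sum, map_sum, coeff_sum] at hm
  obtain ⟨m', hm', h'⟩ := Finset.exists_ne_zero_of_sum_ne_zero hm
  exact ⟨m', mem_support_iff.1 hm', h.map_monomial _ _ h'⟩

theorem isWeightedHomogeneous (h : IsHomogeneousAlgebra k w w' φ) {p : MvPolynomial σ k} {a : A}
    (hp : IsWeightedHomogeneous w p a) :
    IsWeightedHomogeneous w' (algebraMap (MvPolynomial σ k) (MvPolynomial τ k) p) (φ a) := by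
  intro m hm
  obtain ⟨m', h1, h2⟩ := h.exists_coeff_ne_zero p hm
  rw [h2, hp h1]

theorem constantCoeff_algebraMap (h : IsHomogeneousAlgebra k w w' φ) (p : MvPolynomial σ k) :
    constantCoeff (algebraMap (MvPolynomial σ k) (MvPolynomial τ k) p) = constantCoeff p := by
  have : constantCoeff.comp (algebraMap (MvPolynomial σ k) (MvPolynomial τ k)) =
      constantCoeff := by
    refine MvPolynomial.ringHom_ext (fun c => ?_) fun i => ?_
    · rw [RingHom.comp_apply, h.map_C, constantCoeff_C, constantCoeff_C]
    · rw [RingHom.comp_apply, h.constantCoeff_map_X, constantCoeff_X]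
  exact RingHom.congr_fun this p

/-- The extended ideal is spanned additively by products of a monomial with the image of a
homogeneous element of `I`. Such a product has a single degree, so each of its components is itself
or zero. -/
theorem weightedHomogeneousComponent_mem_map (h : IsHomogeneousAlgebra k w w' φ)
    {I : Ideal (MvPolynomial σ k)} (hI : ∀ p ∈ I, ∀ a, weightedHomogeneousComponent w a p ∈ I)
    (z : MvPolynomial τ k) (hz : z ∈ I.map (algebraMap (MvPolynomial σ k) (MvPolynomial τ k)))
    (b : B) : weightedHomogeneousComponent w' b z ∈
      I.map (algebraMap (MvPolynomial σ k) (MvPolynomial τ k)) := by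
  classical
  have key : ∀ (r : MvPolynomial τ k) (a : A) (p : MvPolynomial σ k), p ∈ I →
      IsWeightedHomogeneous w p a → weightedHomogeneousComponent w' b
        (r * algebraMap (MvPolynomial σ k) (MvPolynomial τ k) p) ∈
      I.map (algebraMap (MvPolynomial σ k) (MvPolynomial τ k)) := by
    intro r a p hp hpa
    rw [r.as_sum, Finset.sum_mul, map_sum]
    refine Submodule.sum_mem _ fun m _ => ?_
    rw [weightedHomogeneousComponent_of_mem ((h.isWeightedHomogeneous hpa).monomial_mul m _)]
    split_ifs
    · exact Ideal.mul_mem_left _ _ (Ideal.mem_map_of_mem _ hp)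
    · exact zero_mem _
  have hz' : z ∈ I • (⊤ : Submodule (MvPolynomial σ k) (MvPolynomial τ k)) := by
    rwa [Ideal.smul_top_eq_map]
  refine Submodule.smul_induction_on (p := fun z => weightedHomogeneousComponent w' b z ∈ _) hz'
    ?_ fun x y hx hy => by rw [map_add]; exact add_mem hx hy
  intro p hp r _
  obtain ⟨T, hT⟩ := exists_sum_weightedHomogeneousComponent w p
  rw [Algebra.smul_def, mul_comm, hT, map_sum, Finset.mul_sum, map_sum]
  exact Submodule.sum_mem _ fun a _ => key r a _ (hI p hp a)
    (weightedHomogeneousComponent_isWeightedHomogeneous _ _)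

end IsHomogeneousAlgebra

namespace MinimalGradedFreeResolution

variable {Λ M M' : Type*} [AddCommGroup M] [Module k M] [Module (MvPolynomial σ k) M]
  [AddCommGroup M'] [Module k M'] [Module (MvPolynomial τ k) M']
  {𝓜 : A → Submodule k M} {𝓜' : B → Submodule k M'}

theorem aug_apply (F : MinimalGradedFreeResolution w 𝓜) (u : Fin (F.rank 0) → MvPolynomial σ k) :
    F.aug u = ∑ b, u b • F.aug (Pi.single b 1) := by
  have : F.aug = Fintype.linearCombination (MvPolynomial σ k) fun b => F.aug (Pi.single b 1) :=
    LinearMap.pi_ext' fun b => LinearMap.ext_ring (by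
      simp [Fintype.linearCombination_apply_single])
  conv_lhs => rw [this, Fintype.linearCombination_apply]

/-- Base change of a minimal graded free resolution along a free homogeneous algebra. -/
noncomputable def baseChange (h : IsHomogeneousAlgebra k w w' φ)
    (bas : Module.Basis Λ (MvPolynomial σ k) (MvPolynomial τ k))
    (F : MinimalGradedFreeResolution w 𝓜)
    (aug : (Fin (F.rank 0) → MvPolynomial τ k) →ₗ[MvPolynomial τ k] M')
    (aug_mem : ∀ b, aug (Pi.single b 1) ∈ 𝓜' (φ (F.deg 0 b)))
    (aug_surjective : Function.Surjective aug)
    (aug_eq_zero_iff : ∀ u, aug u = 0 ↔ ∀ l, F.aug (bas.coordVec u l) = 0) :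
    MinimalGradedFreeResolution w' 𝓜' where
  rank := F.rank
  deg i b := φ (F.deg i b)
  d i := (F.d i).map (algebraMap _ _)
  aug := aug
  aug_mem := aug_mem
  d_homogeneous i b c m hm := by
    obtain ⟨m', h1, h2⟩ := h.exists_coeff_ne_zero _ hm
    rw [h2, ← map_add, F.d_homogeneous i b c m' h1]
  aug_surjective := aug_surjective
  exact_zero := by
    intro v
    rw [aug_eq_zero_iff]
    constructor
    · intro hv
      obtain ⟨u, hu⟩ := bas.exists_forall_coordVec
        (P := fun l u => (F.d 0).mulVec u = bas.coordVec v l)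
        (fun l => (F.mem_range_zero_iff _).2 (hv l)) (bas.finite_setOf_coordVec_ne_zero v)
        (fun l hl => by rw [Matrix.mulVec_zero, not_not.1 hl])
      exact ⟨u, bas.ext_coordVec fun l => by
        rw [Matrix.mulVecLin_apply, bas.coordVec_mulVec, hu]⟩
    · rintro ⟨u, rfl⟩ l
      rw [Matrix.mulVecLin_apply, bas.coordVec_mulVec, ← F.mem_range_zero_iff]
      exact ⟨_, rfl⟩
  exact_succ i := bas.exact_map_algebraMap (F.exact_succ i)
  minimal i b c := by
    rw [Matrix.map_apply, h.constantCoeff_algebraMap, F.minimal]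

end MinimalGradedFreeResolution

theorem hasGradedBettiNumbers_of_resolution {M : Type*} [AddCommGroup M]
    [Module k M] [Module (MvPolynomial σ k) M] {𝓜 : A → Submodule k M}
    (hM : IsGradedFamily k w fun a => (𝓜 a : Set M)) (F : MinimalGradedFreeResolution w 𝓜)
    {β : ℕ → A → ℕ} (hβ : ∀ i a, F.betti i a = β i a) : HasGradedBettiNumbers w 𝓜 β :=
  ⟨⟨F⟩, fun G i a => (G.betti_eq hM F i a).trans (hβ i a)⟩

variable {Λ : Type*} {I : Ideal (MvPolynomial σ k)}

/-- Betti numbers of the extension of a homogeneous ideal to a free homogeneous algebra. -/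
theorem hasGradedBettiNumbers_idealGrading_map (h : IsHomogeneousAlgebra k w w' φ)
    (bas : Module.Basis Λ (MvPolynomial σ k) (MvPolynomial τ k))
    (hI : ∀ p ∈ I, ∀ a, weightedHomogeneousComponent w a p ∈ I)
    (F : MinimalGradedFreeResolution w (idealGrading w I)) :
    HasGradedBettiNumbers w' (idealGrading w'
      (I.map (algebraMap (MvPolynomial σ k) (MvPolynomial τ k)))) (regradeBetti φ F.betti) := by
  set J := I.map (algebraMap (MvPolynomial σ k) (MvPolynomial τ k)) with hJ
  let t : Fin (F.rank 0) → MvPolynomial σ k := fun b => F.aug (Pi.single b 1)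
  have haug : ∀ u, (F.aug u : MvPolynomial σ k) = ∑ b, u b * t b := by
    intro u
    rw [F.aug_apply, AddSubmonoidClass.coe_finsetSum]
    rfl
  let x : Fin (F.rank 0) → J := fun b =>
    ⟨algebraMap (MvPolynomial σ k) (MvPolynomial τ k) (t b), Ideal.mem_map_of_mem _ (F.aug _).2⟩
  have hx : ∀ u, (Fintype.linearCombination (MvPolynomial τ k) x u : MvPolynomial τ k) =
      ∑ b, u b * algebraMap (MvPolynomial σ k) (MvPolynomial τ k) (t b) := by
    intro u
    rw [Fintype.linearCombination_apply, AddSubmonoidClass.coe_finsetSum]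
    rfl
  -- The new augmentation acts on coordinates as the old one, so surjectivity and kernel can be read
  -- off one coordinate at a time.
  have hcoord : ∀ u l, bas.repr (Fintype.linearCombination (MvPolynomial τ k) x u :
      MvPolynomial τ k) l = F.aug (bas.coordVec u l) := by
    intro u l
    rw [hx, bas.repr_sum_mul_algebraMap, haug]
  refine hasGradedBettiNumbers_of_resolution
    (isGradedFamily_idealGrading (h.weightedHomogeneousComponent_mem_map hI))
    (F.baseChange h bas (Fintype.linearCombination (MvPolynomial τ k) x) ?_ ?_ ?_)
    (F.card_eq_regradeBetti φ)
  · intro b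
    rw [Fintype.linearCombination_apply_single, one_smul]
    exact h.isWeightedHomogeneous (F.aug_mem b)
  · intro z
    have hz := bas.mem_ideal_map_iff.1 z.2
    obtain ⟨u, hu⟩ := bas.exists_forall_coordVec (ι := Fin (F.rank 0))
      (P := fun l u => (F.aug u : MvPolynomial σ k) = bas.repr z.1 l)
      (fun l => by
        obtain ⟨u, hu⟩ := F.aug_surjective ⟨_, hz l⟩
        exact ⟨u, congrArg Subtype.val hu⟩)
      (bas.repr z.1).hasFiniteSupport (fun l hl => by
        rw [map_zero, Function.notMem_support.1 hl]
        rfl)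
    exact ⟨u, Subtype.ext (bas.ext_elem fun l => by rw [hcoord, hu])⟩
  · intro u
    rw [← ZeroMemClass.coe_eq_zero, ← bas.repr.map_eq_zero_iff, Finsupp.ext_iff]
    simp only [← ZeroMemClass.coe_eq_zero (S' := I), hcoord]
    rfl

/-- As for ideals, with homogeneous representatives `t` of the generators: equality modulo `J` is
tested by coordinates modulo `I`. -/
theorem hasGradedBettiNumbers_quotientGrading_map (h : IsHomogeneousAlgebra k w w' φ)
    (bas : Module.Basis Λ (MvPolynomial σ k) (MvPolynomial τ k))
    (hI : ∀ p ∈ I, ∀ a, weightedHomogeneousComponent w a p ∈ I)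
    (F : MinimalGradedFreeResolution w (quotientGrading w I)) :
    HasGradedBettiNumbers w' (quotientGrading w'
      (I.map (algebraMap (MvPolynomial σ k) (MvPolynomial τ k)))) (regradeBetti φ F.betti) := by
  set J := I.map (algebraMap (MvPolynomial σ k) (MvPolynomial τ k)) with hJ
  have ht' : ∀ b, ∃ t : MvPolynomial σ k, IsWeightedHomogeneous w t (F.deg 0 b) ∧
      Ideal.Quotient.mk I t = F.aug (Pi.single b 1) := F.aug_mem
  choose t ht ht' using ht'
  have haug : ∀ u, F.aug u = Ideal.Quotient.mk I (∑ b, u b * t b) := by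
    intro u
    rw [F.aug_apply, map_sum]
    refine Finset.sum_congr rfl fun b _ => ?_
    rw [← ht']
    rfl
  let x : Fin (F.rank 0) → MvPolynomial τ k ⧸ J := fun b =>
    Ideal.Quotient.mk J (algebraMap (MvPolynomial σ k) (MvPolynomial τ k) (t b))
  have hx : ∀ u, Fintype.linearCombination (MvPolynomial τ k) x u = Ideal.Quotient.mk J
      (∑ b, u b * algebraMap (MvPolynomial σ k) (MvPolynomial τ k) (t b)) := by
    intro u
    rw [Fintype.linearCombination_apply, map_sum]
    rfl
  refine hasGradedBettiNumbers_of_resolution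
    (isGradedFamily_quotientGrading (h.weightedHomogeneousComponent_mem_map hI))
    (F.baseChange h bas (Fintype.linearCombination (MvPolynomial τ k) x) ?_ ?_ ?_)
    (F.card_eq_regradeBetti φ)
  · intro b
    rw [Fintype.linearCombination_apply_single, one_smul]
    exact ⟨_, h.isWeightedHomogeneous (ht b), rfl⟩
  · intro z
    obtain ⟨z, rfl⟩ := Ideal.Quotient.mk_surjective z
    obtain ⟨u, hu⟩ := bas.exists_forall_coordVec (ι := Fin (F.rank 0))
      (P := fun l u => F.aug u = Ideal.Quotient.mk I (bas.repr z l))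
      (fun l => F.aug_surjective _)
      (bas.repr z).hasFiniteSupport (fun l hl => by
        rw [map_zero, Function.notMem_support.1 hl, map_zero])
    refine ⟨u, ?_⟩
    rw [hx, Ideal.Quotient.eq, hJ, bas.mem_ideal_map_iff]
    intro l
    rw [map_sub, Finsupp.sub_apply, bas.repr_sum_mul_algebraMap, ← Ideal.Quotient.eq, ← haug, hu]
  · intro u
    rw [hx, Ideal.Quotient.eq_zero_iff_mem, hJ, bas.mem_ideal_map_iff]
    refine forall_congr' fun l => ?_
    rw [bas.repr_sum_mul_algebraMap, haug, Ideal.Quotient.eq_zero_iff_mem]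

end HomogeneousAlgebraMap

/-! ### Freeness over a homogeneous regular sequence -/

theorem MvPolynomial.aeval_eq_eval₂_finSuccEquiv {k R : Type*} [CommRing k] [CommRing R]
    [Algebra k R] {s : ℕ} (f : Fin (s + 1) → R) (p : MvPolynomial (Fin (s + 1)) k) :
    aeval f p = (finSuccEquiv k s p).eval₂ (aeval fun i : Fin s => f i.succ).toRingHom (f 0) := by
  induction p using MvPolynomial.induction_on with
  | C a =>
    rw [← algebraMap_eq, AlgEquiv.commutes, AlgHom.commutes, Polynomial.algebraMap_apply,
      Polynomial.eval₂_C]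
    simp
  | add p q hp hq => rw [map_add, map_add, Polynomial.eval₂_add, hp, hq]
  | mul_X p i hp =>
    rw [map_mul, map_mul, Polynomial.eval₂_mul, hp, aeval_X]
    congr 1
    refine Fin.cases ?_ (fun j => ?_) i
    · rw [finSuccEquiv_X_zero, Polynomial.eval₂_X]
    · rw [finSuccEquiv_X_succ, Polynomial.eval₂_C]
      simp

open scoped Pointwise in
/-- Elements of a module that are linearly independent over `k` modulo a regular sequence are
linearly independent over the polynomial ring acting through the regular sequence. -/
theorem RingTheory.Sequence.IsWeaklyRegular.eq_zero_of_sum_aeval_smul_eq_zero {k R Λ : Type*}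
    [Field k] [CommRing R] [Algebra k R] (s : ℕ) {M : Type*} [AddCommGroup M] [Module R M]
    (f : Fin s → R) (hreg : RingTheory.Sequence.IsWeaklyRegular M (List.ofFn f)) (v : Λ → M)
    (hv : ∀ a : Λ →₀ k, (a.sum fun l x => algebraMap k R x • v l) ∈
      (Ideal.ofList (List.ofFn f) • ⊤ : Submodule R M) → a = 0)
    (c : Λ →₀ MvPolynomial (Fin s) k) (hc : (c.sum fun l p => aeval f p • v l) = 0) : c = 0 := by
  induction s generalizing M with
  | zero =>
    have hC : ∀ p : MvPolynomial (Fin 0) k, p = C (constantCoeff p) := fun p => by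
      conv_lhs => rw [eq_C_of_isEmpty p]
      rw [constantCoeff_eq]
    have h0 : c.mapRange constantCoeff (map_zero _) = 0 := by
      refine hv _ ?_
      rw [Finsupp.sum_mapRange_index (by simp)]
      have : (c.sum fun l p => algebraMap k R (constantCoeff p) • v l) = 0 := by
        rw [← hc]
        refine Finset.sum_congr rfl fun l _ => ?_
        change algebraMap k R (constantCoeff (c l)) • v l = aeval f (c l) • v l
        conv_rhs => rw [hC (c l), aeval_C]
      rw [this]
      exact zero_mem _
    ext1 l
    rw [hC (c l), ← Finsupp.mapRange_apply (hf := map_zero _), h0]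
    simp
  | succ s ih =>
    rw [List.ofFn_succ, RingTheory.Sequence.isWeaklyRegular_cons_iff] at hreg
    obtain ⟨h0, hreg⟩ := hreg
    let ev : Polynomial (MvPolynomial (Fin s) k) →+* R :=
      Polynomial.eval₂RingHom (aeval fun i : Fin s => f i.succ).toRingHom (f 0)
    have hev : ∀ q, ev q = ev q.divX * f 0 + aeval (fun i : Fin s => f i.succ) (q.coeff 0) := by
      intro q
      conv_lhs => rw [← Polynomial.divX_mul_X_add q]
      simp [ev]
    -- Modulo `f 0` only the coefficients of degree zero in the first variable survive, and the
    -- induction hypothesis for `M / f 0 M` makes them vanish.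
    have hcoeff : ∀ c : Λ →₀ Polynomial (MvPolynomial (Fin s) k),
        (c.sum fun l q => ev q • v l) = 0 → ∀ l, (c l).coeff 0 = 0 := by
      intro c hc
      have := ih (M := QuotSMulTop (f 0) M) (fun i => f i.succ) hreg
        (fun l => Submodule.Quotient.mk (v l)) ?_
        (c.mapRange (fun q => q.coeff 0) (Polynomial.coeff_zero 0)) ?_
      · intro l
        rw [← Finsupp.mapRange_apply (f := fun q : Polynomial (MvPolynomial (Fin s) k) =>
          q.coeff 0) (hf := Polynomial.coeff_zero 0), this, Finsupp.zero_apply]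
      · intro a ha
        refine hv a ?_
        have h1 : (a.sum fun l x => algebraMap k R x •
            (Submodule.Quotient.mk (v l) : QuotSMulTop (f 0) M)) =
            Submodule.mkQ _ (a.sum fun l x => algebraMap k R x • v l) := by
          rw [Finsupp.sum, Finsupp.sum, map_sum]
          rfl
        rw [h1, ← Submodule.mem_comap, Submodule.comap_smul_top_of_surjective _ _
          (Submodule.mkQ_surjective _), Submodule.ker_mkQ] at ha
        rwa [List.ofFn_succ, Ideal.ofList_cons_smul, sup_comm]
      · rw [Finsupp.sum_mapRange_index (by simp)]
        have h1 : Submodule.mkQ (f 0 • (⊤ : Submodule R M)) (c.sum fun l q => ev q • v l) = 0 := by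
          rw [hc, map_zero]
        rw [← h1, Finsupp.sum, Finsupp.sum, map_sum]
        refine Finset.sum_congr rfl fun l _ => ?_
        rw [hev (c l), add_smul, map_add, mul_comm, mul_smul]
        have h2 : Submodule.mkQ (f 0 • (⊤ : Submodule R M)) (f 0 • ev (c l).divX • v l) = 0 := by
          rw [Submodule.mkQ_apply, Submodule.Quotient.mk_eq_zero]
          exact Submodule.smul_mem_pointwise_smul _ _ _ trivial
        rw [h2, zero_add]
        rfl
    -- Once the constant coefficients vanish, the relation is `f 0` times the relation among the
    -- `divX`. Regularity of `f 0` on `M` cancels the factor, and the degree drops.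
    have key : ∀ (N : ℕ) (c : Λ →₀ Polynomial (MvPolynomial (Fin s) k)),
        (∀ l, (c l).natDegree ≤ N) → (c.sum fun l q => ev q • v l) = 0 → c = 0 := by
      intro N
      induction N with
      | zero =>
        intro c hN hc
        ext1 l
        rw [Polynomial.eq_C_of_natDegree_le_zero (hN l), hcoeff c hc, map_zero, Finsupp.zero_apply]
      | succ N ihN =>
        intro c hN hc
        have h1 : c.mapRange Polynomial.divX Polynomial.divX_zero = 0 := by
          refine ihN _ (fun l => ?_) ?_
          · rw [Finsupp.mapRange_apply, Polynomial.natDegree_divX_eq_natDegree_tsub_one]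
            exact Nat.sub_le_of_le_add (hN l)
          · rw [Finsupp.sum_mapRange_index (by simp)]
            refine h0 ?_
            simp only [smul_zero]
            rw [← hc, Finsupp.smul_sum]
            refine Finset.sum_congr rfl fun l _ => ?_
            change f 0 • ev (c l).divX • v l = ev (c l) • v l
            rw [hev (c l), hcoeff c hc l, map_zero, add_zero, smul_smul, mul_comm]
        ext1 l
        rw [← Polynomial.divX_mul_X_add (c l), hcoeff c hc l, ← Finsupp.mapRange_apply
          (f := Polynomial.divX) (hf := Polynomial.divX_zero), h1]
        simp
    have h1 := key ((c.mapRange (finSuccEquiv k s) (map_zero _)).support.sup fun l =>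
      (finSuccEquiv k s (c l)).natDegree) (c.mapRange (finSuccEquiv k s) (map_zero _))
      (fun l => ?_) ?_
    · ext1 l
      apply (finSuccEquiv k s).injective
      rw [← Finsupp.mapRange_apply (hf := map_zero _), h1]
      simp
    · by_cases hl : l ∈ (c.mapRange (finSuccEquiv k s) (map_zero _)).support
      · exact Finset.le_sup (f := fun l => (finSuccEquiv k s (c l)).natDegree) hl
      · rw [Finsupp.notMem_support_iff.1 hl, Polynomial.natDegree_zero]
        exact Nat.zero_le _
    · rw [Finsupp.sum_mapRange_index (by simp), ← hc]
      exact Finset.sum_congr rfl fun l _ =>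
        congrArg (· • v l) (aeval_eq_eval₂_finSuccEquiv f (c l)).symm

section FreeOverRegularSequence

variable {k τ : Type*} [Field k] {s : ℕ} {f : Fin s → MvPolynomial τ k} {e : Fin s → ℕ}

theorem RingTheory.Sequence.IsRegular.span_range_ne_top {R : Type*} [CommRing R] {f : Fin s → R}
    (hreg : RingTheory.Sequence.IsRegular R (List.ofFn f)) : Ideal.span (Set.range f) ≠ ⊤ := by
  intro h
  refine hreg.top_ne_smul ?_
  rw [Ideal.ofList, smul_eq_mul, Ideal.mul_top, ← h]
  congr 1
  ext x
  simp

/-- A form with nonzero constant term is a nonzero constant, hence a unit, whereas a regular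
sequence generates a proper ideal. This makes the base-changed resolution minimal. -/
theorem constantCoeff_eq_zero_of_isRegular_ofFn
    (hreg : RingTheory.Sequence.IsRegular (MvPolynomial τ k) (List.ofFn f))
    (hf : ∀ i, (f i).IsHomogeneous (e i)) (i : Fin s) : constantCoeff (f i) = 0 := by
  by_contra h
  have h0 : e i = 0 := by
    have := hf i (d := 0) h
    rw [← this, map_zero]
  have h1 : f i = C (coeff 0 (f i)) := by
    rw [← totalDegree_eq_zero_iff_eq_C]
    exact Nat.le_zero.1 (h0 ▸ (hf i).totalDegree_le)
  refine hreg.span_range_ne_top (Ideal.eq_top_of_isUnit_mem _ (Ideal.subset_span ⟨i, rfl⟩) ?_)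
  rw [h1]
  exact (IsUnit.mk0 _ h).map C

theorem degree_pos_of_isRegular_ofFn
    (hreg : RingTheory.Sequence.IsRegular (MvPolynomial τ k) (List.ofFn f))
    (hf : ∀ i, (f i).IsHomogeneous (e i)) (i : Fin s) (hi : f i ≠ 0) : 0 < e i := by
  refine Nat.pos_of_ne_zero fun h0 => hi ?_
  have h1 : f i = C (coeff 0 (f i)) := by
    rw [← totalDegree_eq_zero_iff_eq_C]
    exact Nat.le_zero.1 (h0 ▸ (hf i).totalDegree_le)
  rw [h1, ← constantCoeff_eq, constantCoeff_eq_zero_of_isRegular_ofFn hreg hf, C_0]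

/-- A polynomial ring is free over the subalgebra generated by a homogeneous regular sequence. -/
theorem free_of_isRegular_ofFn [Algebra (MvPolynomial (Fin s) k) (MvPolynomial τ k)]
    (halg : ∀ p, algebraMap (MvPolynomial (Fin s) k) (MvPolynomial τ k) p = aeval f p)
    (hreg : RingTheory.Sequence.IsRegular (MvPolynomial τ k) (List.ofFn f))
    (hf : ∀ i, (f i).IsHomogeneous (e i)) :
    Module.Free (MvPolynomial (Fin s) k) (MvPolynomial τ k) := by
  classical
  set 𝔞 : Ideal (MvPolynomial τ k) := Ideal.span (Set.range f) with h𝔞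
  have h𝔞' : (Ideal.ofList (List.ofFn f) • ⊤ : Submodule _ (MvPolynomial τ k)) = 𝔞 := by
    rw [Ideal.ofList, smul_eq_mul, Ideal.mul_top, h𝔞]
    congr 1
    ext x
    simp
  -- The basis of `R/(f)` is taken among classes of monomials so that its lifts `v` are homogeneous.
  obtain ⟨κ, m, -, hspan, hli⟩ := exists_linearIndependent' k
    (fun m : τ →₀ ℕ => Ideal.Quotient.mkₐ k 𝔞 (monomial m 1))
  let v : κ → MvPolynomial τ k := fun l => monomial (m l) 1
  have hli' : LinearIndependent (MvPolynomial (Fin s) k) v := by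
    rw [linearIndependent_iff]
    intro c hc
    refine hreg.toIsWeaklyRegular.eq_zero_of_sum_aeval_smul_eq_zero s f v ?_ c ?_
    · intro a ha
      rw [h𝔞'] at ha
      refine linearIndependent_iff.1 hli a ?_
      rw [Finsupp.linearCombination_apply]
      have h1 := Ideal.Quotient.eq_zero_iff_mem.2 ha
      rw [Finsupp.sum, map_sum] at h1
      rw [Finsupp.sum, ← h1]
      refine Finset.sum_congr rfl fun l _ => ?_
      rw [Function.comp_apply, ← map_smul, smul_eq_mul, ← Algebra.smul_def]
      rfl
    · rw [← hc, Finsupp.linearCombination_apply]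
      refine Finset.sum_congr rfl fun l _ => ?_
      change aeval f (c l) • v l = c l • v l
      rw [Algebra.smul_def (c l), halg, smul_eq_mul]
  have hmul : ∀ i x, x ∈ Submodule.span (MvPolynomial (Fin s) k) (Set.range v) →
      x * f i ∈ Submodule.span (MvPolynomial (Fin s) k) (Set.range v) := by
    intro i x hx
    have : x * f i = (X i : MvPolynomial (Fin s) k) • x := by
      rw [Algebra.smul_def, halg, aeval_X, mul_comm]
    rw [this]
    exact Submodule.smul_mem _ _ hx
  have hhom : ∀ (d : ℕ) (x : MvPolynomial τ k), x.IsHomogeneous d →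
      x ∈ Submodule.span (MvPolynomial (Fin s) k) (Set.range v) := by
    intro d
    induction d using Nat.strong_induction_on with
    | _ d ih =>
    intro x hx
    have h1 : Ideal.Quotient.mkₐ k 𝔞 x ∈ Submodule.span k
        (Set.range fun m : τ →₀ ℕ => Ideal.Quotient.mkₐ k 𝔞 (monomial m 1)) := by
      rw [x.as_sum, map_sum]
      refine Submodule.sum_mem _ fun m _ => ?_
      have : monomial m (coeff m x) = coeff m x • (monomial m 1 : MvPolynomial τ k) := by
        rw [smul_monomial, smul_eq_mul, mul_one]
      rw [this, map_smul]
      exact Submodule.smul_mem _ _ (Submodule.subset_span ⟨m, rfl⟩)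
    rw [← hspan, Finsupp.mem_span_range_iff_exists_finsupp] at h1
    obtain ⟨c, hc⟩ := h1
    have h2 : x - c.sum (fun l a => a • v l) ∈ 𝔞 := by
      rw [← Ideal.Quotient.eq_zero_iff_mem, map_sub, sub_eq_zero]
      change Ideal.Quotient.mkₐ k 𝔞 x = Ideal.Quotient.mkₐ k 𝔞 _
      rw [← hc, Finsupp.sum, Finsupp.sum, map_sum]
      exact Finset.sum_congr rfl fun l _ => (map_smul _ _ _).symm
    rw [h𝔞, Ideal.mem_span_range_iff_exists_fun] at h2
    obtain ⟨r, hr⟩ := h2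
    -- In degree `d` the element `x` is a combination of members of `v` plus terms `r' * f i` with
    -- `r'` homogeneous of degree less than `d`, to which the induction applies. A vanishing `f i`,
    -- whose degree could be zero, is treated apart.
    have h3 : x = homogeneousComponent d (c.sum (fun l a => a • v l)) +
        ∑ i, homogeneousComponent d (r i * f i) := by
      rw [← map_sum, hr, ← map_add, add_sub_cancel, homogeneousComponent_of_mem hx, if_pos rfl]
    rw [h3]
    refine add_mem ?_ (Submodule.sum_mem _ fun i _ => ?_)
    · rw [Finsupp.sum, map_sum]
      refine Submodule.sum_mem _ fun l _ => ?_
      have : c l • homogeneousComponent d (v l) =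
          (C (c l) : MvPolynomial (Fin s) k) • homogeneousComponent d (v l) := by
        rw [Algebra.smul_def (C (c l) : MvPolynomial (Fin s) k), halg, aeval_C, Algebra.smul_def]
      change homogeneousComponent d (c l • v l) ∈ _
      rw [map_smul, this]
      refine Submodule.smul_mem _ _ ?_
      rw [homogeneousComponent_of_mem (isHomogeneous_monomial (1 : k) (rfl : (m l).degree = _))]
      split_ifs
      · exact Submodule.subset_span ⟨l, rfl⟩
      · exact zero_mem _
    · by_cases hi : f i = 0
      · rw [hi, mul_zero, map_zero]
        exact zero_mem _
      · have hr : r i * f i = ∑ j ∈ Finset.range ((r i).totalDegree + 1),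
            homogeneousComponent j (r i) * f i := by
          rw [← Finset.sum_mul, sum_homogeneousComponent]
        rw [hr, map_sum]
        refine Submodule.sum_mem _ fun j _ => ?_
        rw [homogeneousComponent_of_mem ((homogeneousComponent_isHomogeneous j (r i)).mul (hf i))]
        split_ifs with hd
        · have := degree_pos_of_isRegular_ofFn hreg hf i hi
          exact hmul i _ (ih j (by omega) _ (homogeneousComponent_isHomogeneous j (r i)))
        · exact zero_mem _
  refine Module.Free.of_basis (Module.Basis.mk hli' fun x _ => ?_)
  rw [← sum_homogeneousComponent x]
  exact Submodule.sum_mem _ fun d _ => hhom d _ (homogeneousComponent_isHomogeneous d x)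

end FreeOverRegularSequence

/-! ### The standard grading, the multigrading and their coarsenings -/

theorem nonempty_resolution_idealGrading {σ A k : Type*} [Finite σ] [AddCommMonoid A] [Field k]
    {w : σ → A} {I : Ideal (MvPolynomial σ k)}
    (hI : ∀ p ∈ I, ∀ a, weightedHomogeneousComponent w a p ∈ I)
    (hw : ∀ (m : σ →₀ ℕ) (a : A), Finsupp.weight w m + a = a → m = 0) :
    Nonempty (MinimalGradedFreeResolution w (idealGrading w I)) :=
  (isGradedFamily_idealGrading hI).nonempty_minimalGradedFreeResolution inferInstance hw

theorem nonempty_resolution_quotientGrading {σ A k : Type*} [Finite σ] [AddCommMonoid A] [Field k]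
    {w : σ → A} {I : Ideal (MvPolynomial σ k)}
    (hI : ∀ p ∈ I, ∀ a, weightedHomogeneousComponent w a p ∈ I)
    (hw : ∀ (m : σ →₀ ℕ) (a : A), Finsupp.weight w m + a = a → m = 0) :
    Nonempty (MinimalGradedFreeResolution w (quotientGrading w I)) :=
  (isGradedFamily_quotientGrading hI).nonempty_minimalGradedFreeResolution inferInstance hw

theorem eq_zero_of_weight_one_add_eq {σ : Type*} (m : σ →₀ ℕ) (a : ℕ)
    (h : Finsupp.weight (1 : σ → ℕ) m + a = a) : m = 0 := by
  rw [add_eq_right] at h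
  exact (Finsupp.degree_eq_zero_iff m).1 (by rw [Finsupp.degree_eq_weight_one]; exact h)

theorem weight_single_one {σ : Type*} (m : σ →₀ ℕ) :
    Finsupp.weight (fun i : σ => Finsupp.single i 1) m = m := by
  rw [Finsupp.weight_apply]
  simp

theorem IsMonomialIdeal.weightedHomogeneousComponent_mem {σ k : Type*} [Field k]
    {I : Ideal (MvPolynomial σ k)} (hI : IsMonomialIdeal I) (p : MvPolynomial σ k) (hp : p ∈ I)
    (a : σ →₀ ℕ) : weightedHomogeneousComponent (fun i => Finsupp.single i 1) a p ∈ I := by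
  classical
  obtain ⟨E, rfl⟩ := hI
  rw [mem_ideal_span_monomial_image] at hp ⊢
  intro m hm
  rw [mem_support_iff, coeff_weightedHomogeneousComponent] at hm
  refine hp m (mem_support_iff.2 fun h => ?_)
  simp [h] at hm

theorem Ideal.IsHomogeneous.weightedHomogeneousComponent_mem {σ k : Type*} [Field k]
    {I : Ideal (MvPolynomial σ k)} (hI : I.IsHomogeneous (homogeneousSubmodule σ k))
    (p : MvPolynomial σ k) (hp : p ∈ I) (a : ℕ) :
    weightedHomogeneousComponent (1 : σ → ℕ) a p ∈ I := by
  change homogeneousComponent a p ∈ I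
  rw [← decomposition.decompose'_apply p a]
  exact hI a hp

/-- Coarsening the grading is base change along the identity, with the one-element basis; this
brings it under the general base change theorems. -/
theorem isHomogeneousAlgebra_id {σ A B k : Type*} [AddCommMonoid A] [AddCommMonoid B] [Field k]
    {w : σ → A} {w' : σ → B} {φ : A →+ B} (h : ∀ i, φ (w i) = w' i) :
    IsHomogeneousAlgebra k w w' φ where
  map_C _ := rfl
  map_X i := by
    rw [h]
    exact isWeightedHomogeneous_X k w' i
  constantCoeff_map_X := constantCoeff_X k

theorem IsHomogeneousAlgebra.of_isRegular_ofFn {k A : Type*} [Field k] [AddCommMonoid A] {s n : ℕ}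
    [Algebra (MvPolynomial (Fin s) k) (MvPolynomial (Fin n) k)]
    {f : Fin s → MvPolynomial (Fin n) k}
    (halg : ∀ p, algebraMap (MvPolynomial (Fin s) k) (MvPolynomial (Fin n) k) p = aeval f p)
    (hreg : RingTheory.Sequence.IsRegular (MvPolynomial (Fin n) k) (List.ofFn f))
    {e : Fin s → ℕ} (hf : ∀ i, (f i).IsHomogeneous (e i)) {w : Fin s → A} {φ : A →+ ℕ}
    (h : ∀ i, φ (w i) = e i) : IsHomogeneousAlgebra k w (1 : Fin n → ℕ) φ where
  map_C c := by rw [halg, aeval_C]; rfl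
  map_X i := by
    rw [halg, aeval_X, h]
    exact hf i
  constantCoeff_map_X i := by
    rw [halg, aeval_X]
    exact constantCoeff_eq_zero_of_isRegular_ofFn hreg hf i

section Coarsening

variable {σ A B k : Type*} [AddCommMonoid A] [AddCommMonoid B] [Field k]
  {w : σ → A} {w' : σ → B} {φ : A →+ B} {I : Ideal (MvPolynomial σ k)}

theorem hasGradedBettiNumbers_idealGrading_coarsen (h : ∀ i, φ (w i) = w' i)
    (hI : ∀ p ∈ I, ∀ a, weightedHomogeneousComponent w a p ∈ I)
    (F : MinimalGradedFreeResolution w (idealGrading w I)) :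
    HasGradedBettiNumbers w' (idealGrading w' I) (regradeBetti φ F.betti) := by
  have := hasGradedBettiNumbers_idealGrading_map (isHomogeneousAlgebra_id h)
    (Module.Basis.singleton Unit (MvPolynomial σ k)) hI F
  rwa [Algebra.algebraMap_self, Ideal.map_id] at this

theorem hasGradedBettiNumbers_quotientGrading_coarsen (h : ∀ i, φ (w i) = w' i)
    (hI : ∀ p ∈ I, ∀ a, weightedHomogeneousComponent w a p ∈ I)
    (F : MinimalGradedFreeResolution w (quotientGrading w I)) :
    HasGradedBettiNumbers w' (quotientGrading w' I) (regradeBetti φ F.betti) := by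
  have := hasGradedBettiNumbers_quotientGrading_map (isHomogeneousAlgebra_id h)
    (Module.Basis.singleton Unit (MvPolynomial σ k)) hI F
  rwa [Algebra.algebraMap_self, Ideal.map_id] at this

end Coarsening

/-- The degree `∑ l, a l * e l` of a multidegree. -/
def weightHom {s : ℕ} (e : Fin s → ℕ) : (Fin s →₀ ℕ) →+ ℕ where
  toFun a := ∑ i, a i * e i
  map_zero' := by simp
  map_add' a b := by simp [add_mul, Finset.sum_add_distrib]

theorem weightHom_single {s : ℕ} (e : Fin s → ℕ) (i : Fin s) :
    weightHom e (Finsupp.single i 1) = e i := by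
  change ∑ j, Finsupp.single i 1 j * e j = e i
  rw [Finset.sum_eq_single i] <;> simp +contextual

/-- The total degree of a multidegree. -/
def totalDegreeHom (s : ℕ) : (Fin s →₀ ℕ) →+ ℕ where
  toFun a := ∑ i, a i
  map_zero' := by simp
  map_add' a b := by simp [Finset.sum_add_distrib]

theorem totalDegreeHom_single {s : ℕ} (i : Fin s) :
    totalDegreeHom s (Finsupp.single i 1) = 1 := by
  change ∑ j, Finsupp.single i 1 j = 1
  simp

/-! ### Depth, associated primes and Cohen–Macaulay local rings -/

open IsLocalRing RingTheory.Sequence CategoryTheory Abelian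

section Depth

variable {L : Type*} [CommRing L] [IsLocalRing L] [IsNoetherianRing L]

open scoped Pointwise in
/-- The depth of a local ring drops by one modulo a regular element. -/
theorem IsLocalRing.exists_isRegular_quotSMulTop {n : ℕ} {rs : List L} (hlen : rs.length = n + 1)
    (hmem : ∀ r ∈ rs, r ∈ maximalIdeal L) (hreg : IsRegular L rs) {x : L}
    (hx : x ∈ maximalIdeal L) (hxreg : IsSMulRegular L x) :
    ∃ rs' : List L, rs'.length = n ∧ (∀ r ∈ rs', r ∈ maximalIdeal L) ∧
      IsRegular (QuotSMulTop x L) rs' := by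
  have hlt : ∀ (M : Type _) [AddCommGroup M] [Module L M] [Module.Finite L M] [Nontrivial M],
      maximalIdeal L • (⊤ : Submodule L M) < ⊤ := fun M _ _ _ _ =>
    lt_top_iff_ne_top.2 (Ne.symm (Submodule.top_ne_ideal_smul_of_le_jacobson_annihilator
      (IsLocalRing.maximalIdeal_le_jacobson _)))
  have hsupp : Module.support L (L ⧸ maximalIdeal L) =
      PrimeSpectrum.zeroLocus (maximalIdeal L : Set L) := by
    rw [Module.support_eq_zeroLocus, Ideal.annihilator_quotient]
  -- Depth is detected by the vanishing of `Ext` from the residue field. The groups into `L` vanish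
  -- in degrees up to `n`, so by the long exact sequence of multiplication by `x` those into `L /
  -- xL` vanish in degrees below `n`.
  have hext := ModuleCat.subsingleton_ext_of_exists_isRegular (maximalIdeal L)
    (ModuleCat.of L (L ⧸ maximalIdeal L)) hsupp.subset (ModuleCat.of L L) (hlt L) rs hmem hreg
  have : Nontrivial (QuotSMulTop x L) := nontrivial_quotSMulTop_of_mem_maximalIdeal L hx
  refine ModuleCat.exists_isRegular_of_exists_subsingleton_ext (maximalIdeal L) n
    (ModuleCat.of L (QuotSMulTop x L)) (hlt _) (ModuleCat.of L (L ⧸ maximalIdeal L)) hsupp ?_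
  intro i hi
  have zero1 := AddCommGrpCat.isZero_of_iff_subsingleton.mpr (hext i (by omega))
  have zero2 := AddCommGrpCat.isZero_of_iff_subsingleton.mpr (hext (i + 1) (by omega))
  exact AddCommGrpCat.subsingleton_of_isZero <| ShortComplex.Exact.isZero_of_both_zeros
    ((Ext.covariant_sequence_exact₃' (ModuleCat.of L (L ⧸ maximalIdeal L))
      (IsSMulRegular.smulShortComplex_shortExact (M := ModuleCat.of L L) hxreg)) i (i + 1) rfl)
    (zero1.eq_zero_of_src _) (zero2.eq_zero_of_tgt _)

open scoped Pointwise in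
/-- An associated prime of `M` is properly contained in one of `M / aM`, for `a` regular. -/
theorem IsLocalRing.exists_associatedPrime_quotSMulTop {M : Type*} [AddCommGroup M] [Module L M]
    [Module.Finite L M] {a : L} (ha : a ∈ maximalIdeal L) (hreg : IsSMulRegular M a)
    {P : Ideal L} (hP : IsAssociatedPrime P M) :
    ∃ Q, IsAssociatedPrime Q (QuotSMulTop a M) ∧ P ≤ Q ∧ a ∈ Q ∧ a ∉ P := by
  classical
  obtain ⟨hprime, m, hm⟩ := isAssociatedPrime_iff.1 hP
  have hmem : ∀ r, r ∈ P ↔ r • m = 0 := fun r => by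
    rw [hm, Submodule.mem_colon_singleton, Submodule.mem_bot]
  have hm0 : m ≠ 0 := by
    rintro rfl
    exact hprime.ne_top ((Ideal.eq_top_iff_one _).2 ((hmem 1).2 (smul_zero _)))
  -- By Krull's intersection theorem `m` is divisible by only finitely many powers of `a`. Dividing
  -- by the largest one gives `y` outside `aM` with the same annihilator `P`; the class of `y` is
  -- then killed by `P` and by `a`.
  have hex : ∃ n, ¬ ∃ y : M, m = a ^ n • y := by
    by_contra! h
    have hne : Ideal.span {a} ≠ ⊤ := fun h1 =>
      (maximalIdeal.isMaximal L).ne_top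
        (top_le_iff.1 (h1 ▸ (Ideal.span_singleton_le_iff_mem _).2 ha))
    have : m ∈ ⨅ i, Ideal.span {a} ^ i • (⊤ : Submodule L M) := by
      rw [Submodule.mem_iInf]
      intro i
      obtain ⟨y, rfl⟩ := h i
      exact Submodule.smul_mem_smul (Ideal.pow_mem_pow (Ideal.mem_span_singleton_self a) i) trivial
    rw [Ideal.iInf_pow_smul_eq_bot_of_isLocalRing _ hne] at this
    exact hm0 ((Submodule.mem_bot L).1 this)
  have hmin := fun j => Nat.find_min hex (m := j)
  have hspec := Nat.find_spec hex
  generalize Nat.find hex = N at hspec hmin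
  obtain _ | j := N
  · exact absurd ⟨m, by simp⟩ hspec
  obtain ⟨y, hy⟩ := not_not.1 (hmin j j.lt_succ_self)
  have hmem' : ∀ r, r ∈ P ↔ r • y = 0 := fun r => by
    rw [hmem, hy, smul_comm]
    exact ⟨fun h => (hreg.pow j).right_eq_zero_of_smul h, fun h => by rw [h, smul_zero]⟩
  have hy0 : (Submodule.Quotient.mk y : QuotSMulTop a M) ≠ 0 := by
    rw [Ne, Submodule.Quotient.mk_eq_zero, Submodule.mem_smul_pointwise_iff_exists]
    rintro ⟨z, -, hz⟩
    exact hspec ⟨z, by rw [hy, ← hz, smul_smul, pow_succ]⟩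
  obtain ⟨Q, hQ, hle⟩ := exists_le_isAssociatedPrime_of_isNoetherianRing L _ hy0
  refine ⟨Q, hQ, fun r hr => hle ?_, hle ?_, fun haP => ?_⟩
  · rw [Submodule.mem_colon_singleton, Submodule.mem_bot, ← Submodule.Quotient.mk_smul,
      (hmem' r).1 hr, Submodule.Quotient.mk_zero]
  · rw [Submodule.mem_colon_singleton, Submodule.mem_bot, ← Submodule.Quotient.mk_smul,
      Submodule.Quotient.mk_eq_zero]
    exact Submodule.smul_mem_pointwise_smul _ _ _ trivial
  · exact hm0 (hreg.right_eq_zero_of_smul ((hmem a).1 haP))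

/-- The length of a regular sequence is at most the dimension of `L / P`, for `P` associated. -/
theorem IsLocalRing.length_le_ringKrullDim_of_isAssociatedPrime (rs : List L) {M : Type*}
    [AddCommGroup M] [Module L M] [Module.Finite L M] (hmem : ∀ r ∈ rs, r ∈ maximalIdeal L)
    (hreg : IsWeaklyRegular M rs) {P : Ideal L} (hP : IsAssociatedPrime P M) :
    ((rs.length : ℕ∞) : WithBot ℕ∞) ≤ ringKrullDim (L ⧸ P) := by
  induction rs generalizing M P with
  | nil =>
    have := hP.isPrime
    simpa using ringKrullDim_nonneg_of_nontrivial
  | cons a rs ih =>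
    rw [isWeaklyRegular_cons_iff] at hreg
    obtain ⟨Q, hQ, hPQ, haQ, haP⟩ := IsLocalRing.exists_associatedPrime_quotSMulTop
      (hmem a (by simp)) hreg.1 hP
    have h1 := ih (fun r hr => hmem r (by simp [hr])) hreg.2 hQ
    have := hP.isPrime
    -- `a` is a nonzero element of the domain `L / P` that vanishes in `L / Q`, so the dimension
    -- drops by at least one.
    have h2 := ringKrullDim_succ_le_of_surjective (Ideal.Quotient.factor hPQ)
      (Ideal.Quotient.factor_surjective hPQ) (r := Ideal.Quotient.mk P a)
      (mem_nonZeroDivisors_of_ne_zero (fun h => haP (Ideal.Quotient.eq_zero_iff_mem.1 h)))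
      (by rw [Ideal.Quotient.factor_mk, Ideal.Quotient.eq_zero_iff_mem]; exact haQ)
    refine le_trans ?_ h2
    rw [List.length_cons]
    push_cast
    gcongr
    exact h1

end Depth

theorem IsCohenMacaulayLocal.of_ringEquiv {A B : Type*} [CommRing A] [CommRing B] [IsLocalRing A]
    [IsLocalRing B] (e : A ≃+* B) (h : IsCohenMacaulayLocal A) : IsCohenMacaulayLocal B := by
  obtain ⟨hN, rs, hmem, hreg, hlen⟩ := h
  refine ⟨isNoetherianRing_of_ringEquiv A e, rs.map e, ?_, ?_, ?_⟩
  · intro r hr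
    obtain ⟨a, ha, rfl⟩ := List.mem_map.1 hr
    have := hmem a ha
    rw [mem_maximalIdeal, mem_nonunits_iff] at this ⊢
    rwa [MulEquiv.isUnit_map]
  · exact (AddEquiv.isRegular_congr (e := e.toAddEquiv) (List.forall₂_map_right_iff.2
      (List.forall₂_same.2 fun a _ x => e.map_mul a x))).1 hreg
  · rw [List.length_map, hlen, ringKrullDim_eq_of_ringEquiv e]

open scoped Pointwise in
/-- A Cohen–Macaulay local ring stays so modulo a regular element. -/
theorem IsCohenMacaulayLocal.quotient_span_singleton {L : Type*} [CommRing L] [IsLocalRing L]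
    (h : IsCohenMacaulayLocal L) {x : L} (hx : x ∈ maximalIdeal L) (hreg : IsSMulRegular L x)
    [IsLocalRing (L ⧸ Ideal.span {x})] : IsCohenMacaulayLocal (L ⧸ Ideal.span {x}) := by
  obtain ⟨hN, rs, hmem, hrs, hlen⟩ := h
  have hdim := ringKrullDim_quotient_span_singleton_succ_eq_ringKrullDim hreg hx
  obtain ⟨n, hn⟩ : ∃ n : ℕ, ringKrullDim (L ⧸ Ideal.span {x}) = ((n : ℕ∞) : WithBot ℕ∞) := by
    rw [← hlen] at hdim
    cases h : ringKrullDim (L ⧸ Ideal.span {x}) with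
    | bot => exact absurd h ringKrullDim_ne_bot
    | coe m =>
      cases m with
      | top => exact absurd h ringKrullDim_ne_top
      | coe m => exact ⟨m, rfl⟩
  have hlen' : rs.length = n + 1 := by
    rw [hn, ← hlen] at hdim
    exact_mod_cast hdim.symm
  obtain ⟨rs', h1, h2, h3⟩ := IsLocalRing.exists_isRegular_quotSMulTop hlen' hmem hrs hx hreg
  have hspan : (Ideal.span {x} : Ideal L) = x • (⊤ : Submodule L L) := by
    rw [← Submodule.ideal_span_singleton_smul, smul_eq_mul, Ideal.mul_top]
  have h2' : ∀ r ∈ rs'.map (algebraMap L (L ⧸ Ideal.span {x})),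
      r ∈ maximalIdeal (L ⧸ Ideal.span {x}) := by
    intro r hr
    obtain ⟨a, ha, rfl⟩ := List.mem_map.1 hr
    have := IsLocalHom.of_surjective (Ideal.Quotient.mk (Ideal.span {x}))
      Ideal.Quotient.mk_surjective
    exact fun hu => h2 a ha ((isUnit_map_iff (Ideal.Quotient.mk (Ideal.span {x})) a).1 hu)
  refine ⟨inferInstance, rs'.map (algebraMap L _), h2', ?_, ?_⟩
  · rw [isRegular_iff_isWeaklyRegular_of_subset_maximalIdeal h2',
      isWeaklyRegular_map_algebraMap_iff]
    exact (LinearEquiv.isWeaklyRegular_congr (Submodule.quotEquivOfEq _ _ hspan) rs').2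
      h3.toIsWeaklyRegular
  · rw [List.length_map, h1, hn]

/-- In a Cohen–Macaulay local ring, an element that cuts down the dimension is regular. -/
theorem IsCohenMacaulayLocal.isSMulRegular_of_ringKrullDim {L : Type*} [CommRing L] [IsLocalRing L]
    (h : IsCohenMacaulayLocal L) {x : L}
    (hdim : ringKrullDim (L ⧸ Ideal.span {x}) + 1 ≤ ringKrullDim L) : IsSMulRegular L x := by
  obtain ⟨hN, rs, hmem, hrs, hlen⟩ := h
  by_contra hx
  -- A zerodivisor `x` lies in some associated prime `P`, and then `dim L ≤ dim L/P ≤ dim L/(x)`,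
  -- against `hdim`.
  have : x ∈ ⋃ p ∈ associatedPrimes L L, (p : Set L) := by
    rw [biUnion_associatedPrimes_eq_compl_regular]
    exact hx
  simp only [Set.mem_iUnion] at this
  obtain ⟨P, hP, hxP⟩ := this
  have h1 := IsLocalRing.length_le_ringKrullDim_of_isAssociatedPrime rs hmem
    hrs.toIsWeaklyRegular hP
  have hle : Ideal.span {x} ≤ P := (Ideal.span_singleton_le_iff_mem _).2 hxP
  have h2 := ringKrullDim_le_of_surjective (Ideal.Quotient.factor hle)
    (Ideal.Quotient.factor_surjective hle)
  rw [← hlen] at hdim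
  have h3 := (add_le_add_left (h1.trans h2) 1).trans hdim
  have : rs.length + 1 ≤ rs.length := by exact_mod_cast h3
  omega

open IsLocalRing RingTheory.Sequence

theorem IsLocalRing.exists_ringKrullDim_eq_natCast (L : Type*) [CommRing L] [IsLocalRing L]
    [IsNoetherianRing L] : ∃ n : ℕ, ringKrullDim L = ((n : ℕ∞) : WithBot ℕ∞) := by
  cases h : ringKrullDim L with
  | bot => exact absurd h ringKrullDim_ne_bot
  | coe m =>
    cases m with
    | top => exact absurd h ringKrullDim_ne_top
    | coe m => exact ⟨m, rfl⟩

/-- Each equation in the maximal ideal lowers the dimension by at most one. -/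
theorem ringKrullDim_le_add_length_of_ker_eq {L L' : Type*} [CommRing L] [IsLocalRing L]
    [IsNoetherianRing L] [CommRing L'] {π : L →+* L'} (hπ : Function.Surjective π)
    {ws : List L} (hmem : ∀ r ∈ ws, r ∈ maximalIdeal L) (hker : RingHom.ker π = Ideal.ofList ws) :
    ringKrullDim L ≤ ringKrullDim L' + ((ws.length : ℕ∞) : WithBot ℕ∞) := by
  classical
  have h := ringKrullDim_le_ringKrullDim_quotient_add_card ws.toFinset fun r hr => by
    rw [SetLike.mem_coe, ringJacobson_eq_maximalIdeal]
    exact hmem r (by simpa using hr)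
  have e := (Ideal.quotEquivOfEq (show Ideal.span (ws.toFinset : Set L) = RingHom.ker π by
    rw [hker, Ideal.ofList]; congr 1; ext; simp)).trans
    (RingHom.quotientKerEquivOfSurjective hπ)
  rw [ringKrullDim_eq_of_ringEquiv e] at h
  refine h.trans ?_
  gcongr
  exact_mod_cast ws.toFinset_card_le

/-- A quotient of a Cohen–Macaulay local ring whose dimension drops by the number of equations
is Cohen–Macaulay. -/
theorem IsCohenMacaulayLocal.of_surjective_of_ker_eq_ofList {L L' : Type*} [CommRing L]
    [IsLocalRing L] [CommRing L'] [IsLocalRing L'] (h : IsCohenMacaulayLocal L)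
    {π : L →+* L'} (hπ : Function.Surjective π) {ws : List L}
    (hmem : ∀ r ∈ ws, r ∈ maximalIdeal L) (hker : RingHom.ker π = Ideal.ofList ws)
    (hdim : ringKrullDim L' + ((ws.length : ℕ∞) : WithBot ℕ∞) ≤ ringKrullDim L) :
    IsCohenMacaulayLocal L' := by
  obtain ⟨n, hn⟩ : ∃ n, n = ws.length := ⟨_, rfl⟩
  induction n generalizing L with
  | zero =>
    obtain rfl := List.length_eq_zero_iff.1 hn.symm
    rw [Ideal.ofList_nil] at hker
    exact h.of_ringEquiv (RingEquiv.ofBijective π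
      ⟨(RingHom.injective_iff_ker_eq_bot π).2 hker, hπ⟩)
  | succ n ih =>
    obtain ⟨x, ws, rfl⟩ := List.exists_cons_of_length_eq_add_one hn.symm
    have := h.1
    have hx : x ∈ maximalIdeal L := hmem x (by simp)
    have hne : Ideal.span {x} ≠ ⊤ := fun h1 => (maximalIdeal.isMaximal L).ne_top
      (top_le_iff.1 (h1 ▸ (Ideal.span_singleton_le_iff_mem _).2 hx))
    have : Nontrivial (L ⧸ Ideal.span {x}) := Ideal.Quotient.nontrivial_iff.2 hne
    have : IsLocalRing (L ⧸ Ideal.span {x}) :=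
      .of_surjective' (Ideal.Quotient.mk _) Ideal.Quotient.mk_surjective
    have hloc := IsLocalHom.of_surjective (Ideal.Quotient.mk (Ideal.span {x}))
      Ideal.Quotient.mk_surjective
    have hle : Ideal.span {x} ≤ RingHom.ker π := by
      rw [hker, Ideal.ofList_cons]
      exact le_sup_left
    have hsurj : Function.Surjective (Ideal.Quotient.lift (Ideal.span {x}) π hle) :=
      Ideal.Quotient.lift_surjective_of_surjective _ _ hπ
    have hker' : RingHom.ker (Ideal.Quotient.lift (Ideal.span {x}) π hle) =
        Ideal.ofList (ws.map (Ideal.Quotient.mk (Ideal.span {x}))) := by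
      rw [Ideal.ker_quotient_lift, hker, Ideal.ofList_cons, Ideal.map_sup, Ideal.map_quotient_self,
        bot_sup_eq, Ideal.map_ofList]
    have hmem' : ∀ r ∈ ws.map (Ideal.Quotient.mk (Ideal.span {x})),
        r ∈ maximalIdeal (L ⧸ Ideal.span {x}) := by
      intro r hr
      obtain ⟨a, ha, rfl⟩ := List.mem_map.1 hr
      exact fun hu => hmem a (by simp [ha]) ((isUnit_map_iff _ a).1 hu)
    -- The last `n` equations lower the dimension of `L/(x)` by at most `n`, so `x` itself must
    -- lower that of `L`. In a Cohen–Macaulay ring this makes `x` regular, and the quotient by it is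
    -- again Cohen–Macaulay.
    have hdim1 := ringKrullDim_le_add_length_of_ker_eq hsurj hmem' hker'
    rw [List.length_map] at hdim1
    have : IsNoetherianRing L' := isNoetherianRing_of_surjective _ _ π hπ
    obtain ⟨a, ha⟩ := IsLocalRing.exists_ringKrullDim_eq_natCast L
    obtain ⟨b, hb⟩ := IsLocalRing.exists_ringKrullDim_eq_natCast L'
    obtain ⟨c, hc⟩ := IsLocalRing.exists_ringKrullDim_eq_natCast (L ⧸ Ideal.span {x})
    rw [ha, hb, List.length_cons] at hdim
    rw [hb, hc] at hdim1
    norm_cast at hdim hdim1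
    have hreg := h.isSMulRegular_of_ringKrullDim (x := x) (by rw [ha, hc]; norm_cast; omega)
    refine ih (h.quotient_span_singleton hx hreg) hsurj hmem' hker' ?_ (by simpa using hn)
    have h2 := ringKrullDim_quotient_span_singleton_succ_eq_ringKrullDim hreg hx
    rw [ha, hc] at h2
    rw [hb, hc, List.length_map]
    norm_cast at h2 ⊢
    omega

open scoped Pointwise in
theorem IsCohenMacaulayLocal.of_quotient_span_singleton {L : Type*} [CommRing L] [IsLocalRing L]
    [IsNoetherianRing L] {x : L} (hx : x ∈ maximalIdeal L) (hreg : IsSMulRegular L x)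
    [IsLocalRing (L ⧸ Ideal.span {x})] (h : IsCohenMacaulayLocal (L ⧸ Ideal.span {x})) :
    IsCohenMacaulayLocal L := by
  obtain ⟨hN, rs, hmem, hrs, hlen⟩ := h
  have hdim := ringKrullDim_quotient_span_singleton_succ_eq_ringKrullDim hreg hx
  obtain ⟨rs, rfl⟩ := List.map_surjective_iff.2
    (Ideal.Quotient.mk_surjective (I := Ideal.span {x})) rs
  have hmem' : ∀ r ∈ x :: rs, r ∈ maximalIdeal L := by
    intro r hr
    obtain rfl | hr := List.mem_cons.1 hr
    · exact hx
    · exact fun hu => hmem _ (List.mem_map_of_mem hr) (hu.map _)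
  have hspan : (Ideal.span {x} : Ideal L) = x • (⊤ : Submodule L L) := by
    rw [← Submodule.ideal_span_singleton_smul, smul_eq_mul, Ideal.mul_top]
  refine ⟨inferInstance, x :: rs, hmem', ?_, ?_⟩
  · rw [isRegular_iff_isWeaklyRegular_of_subset_maximalIdeal hmem', isWeaklyRegular_cons_iff]
    refine ⟨hreg, (LinearEquiv.isWeaklyRegular_congr (Submodule.quotEquivOfEq _ _ hspan) rs).1 ?_⟩
    exact (isWeaklyRegular_map_algebraMap_iff (L ⧸ Ideal.span {x}) _ rs).1 hrs.toIsWeaklyRegular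
  · rw [← hdim, ← hlen, List.length_cons, List.length_map]
    norm_cast

/-! ### Flat local homomorphisms -/

/-- The Cohen–Macaulay property descends along flat local homomorphisms. -/
theorem IsCohenMacaulayLocal.of_flat_isLocalHom {A B : Type*} [CommRing A] [CommRing B]
    [IsLocalRing A] [IsLocalRing B] [IsNoetherianRing A] [Algebra A B] [Module.Flat A B]
    [IsLocalHom (algebraMap A B)] (h : IsCohenMacaulayLocal B) : IsCohenMacaulayLocal A := by
  obtain ⟨n, hn⟩ := IsLocalRing.exists_ringKrullDim_eq_natCast A
  induction n generalizing A B with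
  | zero =>
    exact ⟨inferInstance, [], by simp, (isRegular_iff_isWeaklyRegular_of_subset_maximalIdeal
      (by simp)).2 (by simp), by rw [hn]; rfl⟩
  | succ n ih =>
    have hN := h.1
    -- A regular element of the maximal ideal stays regular in `B` by flatness, and both rings are
    -- divided by it. The other case, depth zero in positive dimension, is contradictory.
    by_cases hex : ∃ a ∈ maximalIdeal A, IsSMulRegular A a
    · obtain ⟨a, ha, hreg⟩ := hex
      have hne : Ideal.span {a} ≠ ⊤ := fun h1 => (maximalIdeal.isMaximal A).ne_top
        (top_le_iff.1 (h1 ▸ (Ideal.span_singleton_le_iff_mem _).2 ha))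
      have : Nontrivial (A ⧸ Ideal.span {a}) := Ideal.Quotient.nontrivial_iff.2 hne
      have : IsLocalRing (A ⧸ Ideal.span {a}) :=
        .of_surjective' (Ideal.Quotient.mk _) Ideal.Quotient.mk_surjective
      have hb : algebraMap A B a ∈ maximalIdeal B := fun hu =>
        ha ((isUnit_map_iff (algebraMap A B) a).1 hu)
      have hregb : IsSMulRegular B (algebraMap A B a) := hreg.of_flat
      have hmap : Ideal.span {algebraMap A B a} = (Ideal.span {a}).map (algebraMap A B) := by
        rw [Ideal.map_span, Set.image_singleton]
      have hne' : Ideal.span {algebraMap A B a} ≠ ⊤ := fun h1 => (maximalIdeal.isMaximal B).ne_top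
        (top_le_iff.1 (h1 ▸ (Ideal.span_singleton_le_iff_mem _).2 hb))
      have : Nontrivial (B ⧸ Ideal.span {algebraMap A B a}) := Ideal.Quotient.nontrivial_iff.2 hne'
      have : IsLocalRing (B ⧸ Ideal.span {algebraMap A B a}) :=
        .of_surjective' (Ideal.Quotient.mk _) Ideal.Quotient.mk_surjective
      have : Nontrivial (B ⧸ (Ideal.span {a}).map (algebraMap A B)) :=
        Ideal.Quotient.nontrivial_iff.2 (hmap ▸ hne')
      have : IsLocalRing (B ⧸ (Ideal.span {a}).map (algebraMap A B)) :=
        .of_surjective' (Ideal.Quotient.mk _) Ideal.Quotient.mk_surjective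
      have hB := (h.quotient_span_singleton hb hregb).of_ringEquiv (Ideal.quotEquivOfEq hmap)
      have : Module.Flat (A ⧸ Ideal.span {a}) (B ⧸ (Ideal.span {a}).map (algebraMap A B)) :=
        .of_linearEquiv
          (Algebra.TensorProduct.quotIdealMapEquivQuotTensor B (Ideal.span {a})).toLinearEquiv
      have : IsLocalHom (algebraMap (A ⧸ Ideal.span {a})
          (B ⧸ (Ideal.span {a}).map (algebraMap A B))) := by
        refine ⟨fun x hx => ?_⟩
        obtain ⟨x, rfl⟩ := Ideal.Quotient.mk_surjective x
        have hloc := IsLocalHom.of_surjective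
          (Ideal.Quotient.mk ((Ideal.span {a}).map (algebraMap A B))) Ideal.Quotient.mk_surjective
        rw [Ideal.Quotient.algebraMap_quotient_map_quotient, isUnit_map_iff, isUnit_map_iff] at hx
        exact hx.map _
      refine .of_quotient_span_singleton ha hreg (ih hB ?_)
      obtain ⟨m, hm⟩ := IsLocalRing.exists_ringKrullDim_eq_natCast (A ⧸ Ideal.span {a})
      have hdim := ringKrullDim_quotient_span_singleton_succ_eq_ringKrullDim hreg ha
      rw [hn, hm] at hdim
      norm_cast at hdim
      rw [hm, Nat.succ.inj hdim]
    · exfalso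
      push Not at hex
      -- By prime avoidance the maximal ideal lies in an associated prime, so it kills some `x ≠ 0`.
      -- The image of `x` in `B` is nonzero and killed by `𝔪_A B`, hence `B` has an associated prime
      -- `Q` containing `𝔪_A B`.
      have hsub : (maximalIdeal A : Set A) ⊆ ⋃ p ∈ associatedPrimes A A, (p : Set A) := by
        rw [biUnion_associatedPrimes_eq_compl_regular]
        exact fun a ha => hex a ha
      obtain ⟨P, hP, hle⟩ := (Ideal.subset_union_prime_finite (associatedPrimes.finite A A)
        (f := id) ⊤ ⊤ (fun P hP _ _ => hP.isPrime)).1 hsub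
      obtain ⟨hprime, x, hx⟩ := isAssociatedPrime_iff.1 hP
      have hx0 : x ≠ 0 := by
        rintro rfl
        exact hprime.ne_top (by rw [hx]; ext; simp [Submodule.mem_colon_singleton])
      have : Module.FaithfullyFlat A B := .of_flat_of_isLocalHom
      have hy0 : algebraMap A B x ≠ 0 := fun h0 =>
        hx0 (FaithfulSMul.algebraMap_injective A B (by rw [h0, map_zero]))
      obtain ⟨Q, hQ, hleQ⟩ := exists_le_isAssociatedPrime_of_isNoetherianRing B _ hy0
      have hmQ : (maximalIdeal A).map (algebraMap A B) ≤ Q := by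
        rw [Ideal.map_le_iff_le_comap]
        intro a ha
        refine hleQ ?_
        have h1 : a ∈ P := hle ha
        rw [hx, Submodule.mem_colon_singleton, Submodule.mem_bot] at h1
        rw [Submodule.mem_colon_singleton, Submodule.mem_bot, smul_eq_mul, ← map_mul,
          ← smul_eq_mul, h1, map_zero]
      obtain ⟨-, rs, hmem, hrs, hlen⟩ := h
      have h1 := IsLocalRing.length_le_ringKrullDim_of_isAssociatedPrime rs hmem
        hrs.toIsWeaklyRegular hQ
      have h2 := h1.trans (ringKrullDim_le_of_surjective (Ideal.Quotient.factor hmQ)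
        (Ideal.Quotient.factor_surjective hmQ))
      have : (maximalIdeal B).LiesOver (maximalIdeal A) :=
        ⟨(maximalIdeal_comap (algebraMap A B)).symm⟩
      have h3 := Ideal.height_eq_height_add_of_liesOver_of_hasGoingDown (maximalIdeal A)
        (maximalIdeal B)
      have hne : (maximalIdeal A).map (algebraMap A B) ≠ ⊤ := fun h1 =>
        hQ.isPrime.ne_top (top_le_iff.1 (h1 ▸ hmQ))
      have : Nontrivial (B ⧸ (maximalIdeal A).map (algebraMap A B)) :=
        Ideal.Quotient.nontrivial_iff.2 hne
      have : IsLocalRing (B ⧸ (maximalIdeal A).map (algebraMap A B)) :=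
        .of_surjective' (Ideal.Quotient.mk _) Ideal.Quotient.mk_surjective
      have h4 : (maximalIdeal B).map (Ideal.Quotient.mk ((maximalIdeal A).map (algebraMap A B))) =
          maximalIdeal _ := map_maximalIdeal_of_surjective _ Ideal.Quotient.mk_surjective
      -- Going-down gives the dimension formula. With `dim B ≤ dim B/Q ≤ dim B/𝔪_A B` it forces `dim
      -- A = 0`, whereas `dim A = n + 1`.
      have h5 : ringKrullDim B = ringKrullDim A +
          ringKrullDim (B ⧸ (maximalIdeal A).map (algebraMap A B)) := by
        rw [← maximalIdeal_height_eq_ringKrullDim, h3, h4, ← maximalIdeal_height_eq_ringKrullDim,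
          ← maximalIdeal_height_eq_ringKrullDim]
        rfl
      obtain ⟨m, hm⟩ := IsLocalRing.exists_ringKrullDim_eq_natCast
        (B ⧸ (maximalIdeal A).map (algebraMap A B))
      rw [hlen, h5, hn, hm] at h2
      norm_cast at h2
      omega

/-- The Cohen–Macaulay property ascends along flat local homomorphisms that preserve the
dimension. -/
theorem IsCohenMacaulayLocal.flat_of_ringKrullDim_eq {A B : Type*} [CommRing A] [CommRing B]
    [IsLocalRing A] [IsLocalRing B] [IsNoetherianRing B] [Algebra A B] [Module.Flat A B]
    [IsLocalHom (algebraMap A B)] (h : IsCohenMacaulayLocal A)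
    (hdim : ringKrullDim B = ringKrullDim A) : IsCohenMacaulayLocal B := by
  obtain ⟨hN, rs, hmem, hrs, hlen⟩ := h
  have hmem' : ∀ r ∈ rs.map (algebraMap A B), r ∈ maximalIdeal B := by
    intro r hr
    obtain ⟨a, ha, rfl⟩ := List.mem_map.1 hr
    exact fun hu => hmem a ha ((isUnit_map_iff (algebraMap A B) a).1 hu)
  exact ⟨inferInstance, _, hmem', (isRegular_iff_isWeaklyRegular_of_subset_maximalIdeal hmem').2
    hrs.toIsWeaklyRegular.of_flat, by rw [List.length_map, hlen, hdim]⟩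

/-! ### Polynomial extensions, descent and quotients for Cohen–Macaulay rings -/

theorem IsCohenMacaulay.of_ringEquiv {A B : Type*} [CommRing A] [CommRing B] (e : A ≃+* B)
    (h : IsCohenMacaulay A) : IsCohenMacaulay B := by
  have := h.1
  refine ⟨isNoetherianRing_of_ringEquiv A e, fun 𝔪 _ => ?_⟩
  have : (𝔪.comap e).IsMaximal := Ideal.comap_isMaximal_of_equiv e
  refine (h.2 (𝔪.comap e)).of_ringEquiv (IsLocalization.ringEquivOfRingEquiv
    (M := (𝔪.comap e).primeCompl) (T := 𝔪.primeCompl) _ _ e ?_)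
  exact Submonoid.map_comap_eq_of_surjective e.surjective 𝔪.primeCompl

/-- A polynomial ring over a Cohen–Macaulay Jacobson ring is Cohen–Macaulay. -/
theorem IsCohenMacaulay.polynomial {A : Type*} [CommRing A] [IsJacobsonRing A]
    (h : IsCohenMacaulay A) : IsCohenMacaulay (Polynomial A) := by
  have := h.1
  refine ⟨inferInstance, fun N _ => ?_⟩
  have hmax : (N.comap Polynomial.C).IsMaximal := Polynomial.isMaximal_comap_C_of_isJacobsonRing N
  set 𝔪 := N.comap Polynomial.C with h𝔪
  have hover : N.LiesOver 𝔪 := ⟨rfl⟩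
  have hht : N.height = 𝔪.height + 1 := Polynomial.height_eq_height_add_one 𝔪 N
  have hfin : 𝔪.height ≠ ⊤ := Ideal.height_ne_top hmax.ne_top
  -- Comparing heights, `N` is larger than the extension of `𝔪`, so it is generated by that
  -- extension and a monic `P`. As `A[X]/(P)` is free over `A`, the local ring at `N` modulo `P` is
  -- flat over `A_𝔪`; it has the same dimension, so it is Cohen–Macaulay, and dividing by the
  -- regular element `P` is undone at the end.
  obtain ⟨P, hP, hN⟩ := Polynomial.exists_monic_span_sup_map_eq A N hmax fun heq => by
    have h1 : N.height = 𝔪.height := by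
      conv_lhs => rw [heq]
      exact Polynomial.height_map_C 𝔪
    rw [hht] at h1
    lift 𝔪.height to ℕ using hfin with a
    norm_cast at h1
    omega
  have hPN : P ∈ N := hN ▸ Ideal.mem_sup_right (Ideal.mem_span_singleton_self P)
  obtain ⟨x, hxP⟩ : ∃ x, x = algebraMap (Polynomial A) (Localization.AtPrime N) P := ⟨_, rfl⟩
  have hx : x ∈ maximalIdeal (Localization.AtPrime N) := 
    hxP ▸ (IsLocalization.AtPrime.to_map_mem_maximal_iff (Localization.AtPrime N) N P).2 hPN
  have hreg : IsSMulRegular (Localization.AtPrime N) x := by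
    have h1 : IsSMulRegular (Polynomial A) P := fun a b hab => hP.isRegular.left hab
    exact hxP ▸ h1.of_flat
  have hmap : Ideal.span {x} =
      (Ideal.span {P}).map (algebraMap (Polynomial A) (Localization.AtPrime N)) := by
    rw [Ideal.map_span, Set.image_singleton, hxP]
  have hne : Ideal.span {x} ≠ ⊤ := fun h1 =>
    (maximalIdeal.isMaximal (Localization.AtPrime N)).ne_top
    (top_le_iff.1 (h1 ▸ (Ideal.span_singleton_le_iff_mem _).2 hx))
  have : Nontrivial (Localization.AtPrime N ⧸ Ideal.span {x}) := Ideal.Quotient.nontrivial_iff.2 hne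
  have : IsLocalRing (Localization.AtPrime N ⧸ Ideal.span {x}) :=
    .of_surjective' (Ideal.Quotient.mk _) Ideal.Quotient.mk_surjective
  have hdim := ringKrullDim_quotient_span_singleton_succ_eq_ringKrullDim hreg hx
  refine .of_quotient_span_singleton hx hreg ?_
  let := Localization.AtPrime.algebraOfLiesOver 𝔪 N
  have hflat1 : Module.Flat A (Localization.AtPrime N ⧸ Ideal.span {x}) := by
    have := hP.free_quotient
    have : Module.Flat (Polynomial A ⧸ Ideal.span {P})
        (Localization.AtPrime N ⧸
          (Ideal.span {P}).map (algebraMap (Polynomial A) (Localization.AtPrime N))) :=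
      IsLocalization.flat (Localization.AtPrime N ⧸
        (Ideal.span {P}).map (algebraMap (Polynomial A) (Localization.AtPrime N)))
        (Algebra.algebraMapSubmonoid (Polynomial A ⧸ Ideal.span {P}) N.primeCompl)
    have : IsScalarTower A (Polynomial A ⧸ Ideal.span {P})
        (Localization.AtPrime N ⧸
          (Ideal.span {P}).map (algebraMap (Polynomial A) (Localization.AtPrime N))) := by
      refine ⟨fun a b c => ?_⟩
      obtain ⟨b, rfl⟩ := Ideal.Quotient.mk_surjective b
      obtain ⟨c, rfl⟩ := Ideal.Quotient.mk_surjective c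
      exact congrArg (Ideal.Quotient.mk _) (smul_assoc a b c)
    have : Module.Flat A (Localization.AtPrime N ⧸
        (Ideal.span {P}).map (algebraMap (Polynomial A) (Localization.AtPrime N))) :=
      Module.Flat.trans A (Polynomial A ⧸ Ideal.span {P}) _
    rw [hmap]
    exact this
  have : Module.Flat (Localization.AtPrime 𝔪) (Localization.AtPrime N ⧸ Ideal.span {x}) := by
    rw [Module.flat_iff_of_isLocalization (Localization.AtPrime 𝔪) 𝔪.primeCompl]
    exact hflat1
  have : IsLocalHom
      (algebraMap (Localization.AtPrime 𝔪) (Localization.AtPrime N ⧸ Ideal.span {x})) := by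
    have hloc : IsLocalHom (Ideal.Quotient.mk (Ideal.span {x})) :=
      .of_surjective _ Ideal.Quotient.mk_surjective
    have h2 : IsLocalHom (algebraMap (Localization.AtPrime 𝔪) (Localization.AtPrime N)) :=
      Localization.isLocalHom_localRingHom 𝔪 N (algebraMap A _) Ideal.LiesOver.over
    exact RingHom.isLocalHom_comp (Ideal.Quotient.mk (Ideal.span {x}))
      (algebraMap _ (Localization.AtPrime N))
  refine (h.2 𝔪).flat_of_ringKrullDim_eq ?_
  rw [IsLocalization.AtPrime.ringKrullDim_eq_height N (Localization.AtPrime N), hht] at hdim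
  rw [IsLocalization.AtPrime.ringKrullDim_eq_height 𝔪 (Localization.AtPrime 𝔪)]
  obtain ⟨c, hc⟩ := IsLocalRing.exists_ringKrullDim_eq_natCast
    (Localization.AtPrime N ⧸ Ideal.span {x})
  rw [hc] at hdim ⊢
  lift 𝔪.height to ℕ using hfin with a
  norm_cast at hdim ⊢
  omega

theorem IsCohenMacaulay.mvPolynomial {A : Type*} [CommRing A] [IsJacobsonRing A]
    (h : IsCohenMacaulay A) (n : ℕ) : IsCohenMacaulay (MvPolynomial (Fin n) A) := by
  induction n with
  | zero => exact h.of_ringEquiv (MvPolynomial.isEmptyRingEquiv A (Fin 0)).symm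
  | succ n ih => exact ih.polynomial.of_ringEquiv (MvPolynomial.finSuccEquiv A n).symm.toRingEquiv

/-- The Nullstellensatz for Jacobson rings, one variable at a time. -/
theorem MvPolynomial.isMaximal_comap_C {A : Type*} [CommRing A] [IsJacobsonRing A] {n : ℕ}
    (N : Ideal (MvPolynomial (Fin n) A)) [hN : N.IsMaximal] : (N.comap C).IsMaximal := by
  induction n with
  | zero =>
    exact Ideal.comap_isMaximal_of_equiv (MvPolynomial.isEmptyRingEquiv A (Fin 0)).symm
  | succ n ih =>
    let e := (MvPolynomial.finSuccEquiv A n).symm.toRingEquiv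
    have h1 : (N.comap e).IsMaximal := Ideal.comap_isMaximal_of_equiv e
    have h2 := Polynomial.isMaximal_comap_C_of_isJacobsonRing (N.comap e)
    have h3 := ih _ (hN := h2)
    convert h3 using 1
    ext a
    have h4 : e (Polynomial.C (C a)) = C a := (MvPolynomial.finSuccEquiv A n).symm.commutes a
    simp [h4]

/-- The height of a maximal ideal of a polynomial ring over a Noetherian Jacobson ring. -/
theorem MvPolynomial.height_eq_height_comap_C_add {A : Type*} [CommRing A] [IsNoetherianRing A]
    [IsJacobsonRing A] {n : ℕ} (N : Ideal (MvPolynomial (Fin n) A)) [hN : N.IsMaximal] :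
    N.height = (N.comap C).height + n := by
  induction n with
  | zero =>
    have := (MvPolynomial.isEmptyRingEquiv A (Fin 0)).symm.height_comap N
    rw [Nat.cast_zero, add_zero, ← this]
    rfl
  | succ n ih =>
    let e := (MvPolynomial.finSuccEquiv A n).symm.toRingEquiv
    have h1 : (N.comap e).IsMaximal := Ideal.comap_isMaximal_of_equiv e
    have h2 := Polynomial.isMaximal_comap_C_of_isJacobsonRing (N.comap e)
    have h3 := ih _ (hN := h2)
    have hover : (N.comap e).LiesOver ((N.comap e).comap Polynomial.C) := ⟨rfl⟩
    rw [← e.height_comap N, Polynomial.height_eq_height_add_one ((N.comap e).comap Polynomial.C),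
      h3,
      Nat.cast_succ, add_assoc]
    congr 2
    ext a
    have h4 : e (Polynomial.C (C a)) = C a := (MvPolynomial.finSuccEquiv A n).symm.commutes a
    simp [h4]

/-- The Cohen–Macaulay property descends along faithfully flat homomorphisms. -/
theorem IsCohenMacaulay.of_faithfullyFlat {A B : Type*} [CommRing A] [CommRing B]
    [IsNoetherianRing A] [Algebra A B] [Module.FaithfullyFlat A B] (h : IsCohenMacaulay B) :
    IsCohenMacaulay A := by
  refine ⟨inferInstance, fun 𝔪 hmax => ?_⟩
  obtain ⟨q, hq⟩ := PrimeSpectrum.comap_surjective_of_faithfullyFlat (A := A) (B := B)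
    ⟨𝔪, hmax.isPrime⟩
  -- The prime over `𝔪` is enlarged to a maximal ideal; its contraction is still `𝔪`, because `𝔪` is
  -- maximal.
  obtain ⟨N, hN, hqN⟩ := Ideal.exists_le_maximal q.asIdeal q.isPrime.ne_top
  have hq' : q.asIdeal.comap (algebraMap A B) = 𝔪 := congrArg PrimeSpectrum.asIdeal hq
  have hover : N.LiesOver 𝔪 :=
    ⟨hmax.eq_of_le (hN.isPrime.comap (algebraMap A B)).ne_top (hq' ▸ Ideal.comap_mono hqN)⟩
  let := Localization.AtPrime.algebraOfLiesOver 𝔪 N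
  have : IsLocalHom (algebraMap (Localization.AtPrime 𝔪) (Localization.AtPrime N)) :=
    Localization.isLocalHom_localRingHom 𝔪 N (algebraMap A B) Ideal.LiesOver.over
  exact (h.2 N).of_flat_isLocalHom

theorem Localization.localRingHom_surjective {A B : Type*} [CommRing A] [CommRing B]
    {φ : A →+* B} (hφ : Function.Surjective φ) (N : Ideal B) [N.IsPrime] :
    Function.Surjective (Localization.localRingHom (N.comap φ) N φ rfl) := by
  intro x
  obtain ⟨b, t, rfl⟩ := IsLocalization.exists_mk'_eq N.primeCompl x
  obtain ⟨p, rfl⟩ := hφ b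
  obtain ⟨u, hu⟩ := hφ t
  have hu' : u ∈ (N.comap φ).primeCompl := fun h1 => t.2 (hu ▸ h1)
  refine ⟨IsLocalization.mk' _ p ⟨u, hu'⟩, ?_⟩
  rw [Localization.localRingHom_mk']
  congr 1
  exact Subtype.ext hu

/-- A quotient of a polynomial ring over a Cohen–Macaulay Jacobson ring by `s` equations is
Cohen–Macaulay if its local rings have the expected dimension. -/
theorem IsCohenMacaulay.of_surjective_mvPolynomial {A B : Type*} [CommRing A] [CommRing B]
    [IsJacobsonRing A] (h : IsCohenMacaulay A) {n s : ℕ} {φ : MvPolynomial (Fin n) A →+* B}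
    (hφ : Function.Surjective φ) (w : Fin s → MvPolynomial (Fin n) A)
    (hker : RingHom.ker φ = Ideal.span (Set.range w))
    (hht : ∀ N : Ideal B, N.IsMaximal →
      N.height + s ≤ (N.comap (φ.comp C)).height + n) : IsCohenMacaulay B := by
  have hA := h.1
  have hP := h.mvPolynomial n
  refine ⟨isNoetherianRing_of_surjective _ _ φ hφ, fun N hN => ?_⟩
  have hmax : (N.comap φ).IsMaximal := Ideal.comap_isMaximal_of_surjective φ hφ
  have hT : Submonoid.map φ (N.comap φ).primeCompl = N.primeCompl :=
    Submonoid.map_comap_eq_of_surjective hφ N.primeCompl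
  have hsurj := Localization.localRingHom_surjective hφ N
  have hker' : RingHom.ker (Localization.localRingHom (N.comap φ) N φ rfl) =
      Ideal.ofList ((List.ofFn w).map
        (algebraMap (MvPolynomial (Fin n) A) (Localization.AtPrime (N.comap φ)))) := by
    rw [← Ideal.map_ofList]
    refine (IsLocalization.ker_map (S := Localization.AtPrime (N.comap φ))
      (Localization.AtPrime N) φ hT).trans ?_
    rw [hker, Ideal.ofList]
    congr 2
    ext x
    simp
  refine (hP.2 (N.comap φ)).of_surjective_of_ker_eq_ofList hsurj ?_ hker' ?_
  · intro r hr
    obtain ⟨a, ha, rfl⟩ := List.mem_map.1 hr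
    rw [IsLocalization.AtPrime.to_map_mem_maximal_iff _ (N.comap φ), Ideal.mem_comap]
    obtain ⟨i, rfl⟩ := (List.mem_ofFn' _ _).1 ha
    have h1 : w i ∈ RingHom.ker φ := hker ▸ Ideal.subset_span ⟨i, rfl⟩
    rw [(RingHom.mem_ker).1 h1]
    exact zero_mem _
  · rw [IsLocalization.AtPrime.ringKrullDim_eq_height N,
      IsLocalization.AtPrime.ringKrullDim_eq_height (N.comap φ),
      MvPolynomial.height_eq_height_comap_C_add, List.length_map, List.length_ofFn,
      Ideal.comap_comap]
    exact_mod_cast hht N hN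

/-! ### Dimension count and graph equations for the base change -/

theorem Ideal.height_le_height_comap_of_surjective {A B : Type*} [CommRing A] [CommRing B]
    {φ : A →+* B} (hφ : Function.Surjective φ) (N : Ideal B) [N.IsPrime] :
    N.height ≤ (N.comap φ).height := by
  have hsurj := Localization.localRingHom_surjective hφ N
  have h := ringKrullDim_le_of_surjective _ hsurj
  rw [IsLocalization.AtPrime.ringKrullDim_eq_height N,
    IsLocalization.AtPrime.ringKrullDim_eq_height (N.comap φ)] at h
  exact_mod_cast h

theorem MvPolynomial.height_eq_of_isMaximal {k : Type*} [Field k] {n : ℕ}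
    (N : Ideal (MvPolynomial (Fin n) k)) [N.IsMaximal] : N.height = n := by
  rw [MvPolynomial.height_eq_height_comap_C_add]
  have := MvPolynomial.isMaximal_comap_C N
  have h : N.comap C = ⊥ := (Ideal.eq_bot_or_top _).resolve_right this.ne_top
  rw [h, Ideal.height_bot, zero_add]

/-- The expected dimension of the local rings of a base change of a flat extension of
polynomial rings. -/
theorem MvPolynomial.height_add_le_height_comap_add {k : Type*} [Field k] {s n : ℕ}
    [Algebra (MvPolynomial (Fin s) k) (MvPolynomial (Fin n) k)]
    [Module.Flat (MvPolynomial (Fin s) k) (MvPolynomial (Fin n) k)]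
    (I : Ideal (MvPolynomial (Fin s) k))
    (N : Ideal (MvPolynomial (Fin n) k ⧸
      I.map (algebraMap (MvPolynomial (Fin s) k) (MvPolynomial (Fin n) k)))) [N.IsMaximal]
    [(N.comap (algebraMap (MvPolynomial (Fin s) k ⧸ I) _)).IsMaximal] :
    N.height + s ≤ (N.comap (algebraMap (MvPolynomial (Fin s) k ⧸ I) _)).height + n := by
  set B := MvPolynomial (Fin n) k ⧸
    I.map (algebraMap (MvPolynomial (Fin s) k) (MvPolynomial (Fin n) k))
  set 𝔪 := N.comap (algebraMap (MvPolynomial (Fin s) k ⧸ I) B) with h𝔪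
  let 𝔪' : Ideal (MvPolynomial (Fin s) k) := 𝔪.comap (Ideal.Quotient.mk I)
  let N' : Ideal (MvPolynomial (Fin n) k) := N.comap (Ideal.Quotient.mk _)
  have hmax : 𝔪'.IsMaximal := Ideal.comap_isMaximal_of_surjective _ Ideal.Quotient.mk_surjective
  have hmaxN : N'.IsMaximal := Ideal.comap_isMaximal_of_surjective _ Ideal.Quotient.mk_surjective
  have hover : N.LiesOver 𝔪 := ⟨rfl⟩
  have hover' : N'.LiesOver 𝔪' := ⟨rfl⟩
  -- With flatness the fibre of `S → R` over `𝔪'` has height exactly `n - s` at `N'`. The fibre of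
  -- `S/I → R/J` over `𝔪` is a quotient of it, so `ht N ≤ ht 𝔪 + (n - s)`.
  have h1 := Ideal.height_eq_height_add_of_liesOver_of_hasGoingDown 𝔪' N'
  rw [MvPolynomial.height_eq_of_isMaximal N', MvPolynomial.height_eq_of_isMaximal 𝔪'] at h1
  have h2 := Ideal.height_le_height_add_of_liesOver 𝔪 N
  let q : MvPolynomial (Fin n) k →+* B ⧸ 𝔪.map (algebraMap _ B) :=
    (Ideal.Quotient.mk _).comp (Ideal.Quotient.mk _)
  have hq : Function.Surjective q :=
    Ideal.Quotient.mk_surjective.comp Ideal.Quotient.mk_surjective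
  have hle : ∀ p ∈ 𝔪'.map (algebraMap (MvPolynomial (Fin s) k) (MvPolynomial (Fin n) k)),
      q p = 0 := by
    suffices h : 𝔪'.map (algebraMap (MvPolynomial (Fin s) k) (MvPolynomial (Fin n) k)) ≤
      RingHom.ker q from fun p hp => h hp
    rw [Ideal.map_le_iff_le_comap]
    intro p hp
    have h := Ideal.mem_map_of_mem (algebraMap (MvPolynomial (Fin s) k ⧸ I) B) (I := 𝔪)
      (x := Ideal.Quotient.mk I p) hp
    rw [Ideal.Quotient.algebraMap_quotient_map_quotient] at h
    exact Ideal.Quotient.eq_zero_iff_mem.2 h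
  have hNle : 𝔪.map (algebraMap _ B) ≤ N := Ideal.map_comap_le
  have hprime : (N.map (Ideal.Quotient.mk (𝔪.map (algebraMap _ B)))).IsPrime :=
    Ideal.isPrime_map_quotientMk_of_isPrime hNle
  have h3 := Ideal.height_le_height_comap_of_surjective
    (Ideal.Quotient.lift_surjective_of_surjective _ hle hq)
    (N.map (Ideal.Quotient.mk (𝔪.map (algebraMap _ B))))
  have h4 : (N.map (Ideal.Quotient.mk (𝔪.map (algebraMap _ B)))).comap
      (Ideal.Quotient.lift _ q hle) = N'.map (Ideal.Quotient.mk _) := by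
    ext x
    obtain ⟨x, rfl⟩ := Ideal.Quotient.mk_surjective x
    rw [Ideal.mem_comap, Ideal.Quotient.lift_mk, Ideal.mem_quotient_iff_mem]
    · exact Ideal.mem_quotient_iff_mem hNle
    · rw [Ideal.map_le_iff_le_comap]
      exact fun p hp => hp
  rw [h4] at h3
  rw [h1]
  refine (add_le_add_left (h2.trans (add_le_add_right h3 _)) _).trans_eq ?_
  rw [add_assoc, add_comm _ (s : ℕ∞)]

section BaseChange

variable {k A B : Type*} [CommRing k] [CommRing A] [CommRing B] {s n : ℕ}
  {f : Fin s → MvPolynomial (Fin n) k} {α : MvPolynomial (Fin s) k →+* A} {β : A →+* B}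
  {κ : MvPolynomial (Fin n) k →+* B}

theorem MvPolynomial.eval₂Hom_comp_map_eq (hcomm : ∀ p, β (α p) = κ (aeval f p)) :
    (eval₂Hom β fun j => κ (X j)).comp (map (α.comp C)) = κ := by
  ext a
  · have h := hcomm (C a)
    rw [← algebraMap_eq, AlgHom.commutes] at h
    simpa using h
  · simp

/-- The graph equations generate the kernel of the base change of `k[x]` to a quotient of
`k[y]`. -/
theorem MvPolynomial.ker_eval₂Hom_eq_span (hα : Function.Surjective α)
    (hcomm : ∀ p, β (α p) = κ (aeval f p))
    (hker : RingHom.ker κ = (RingHom.ker α).map (aeval f : _ →ₐ[k] MvPolynomial (Fin n) k)) :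
    RingHom.ker (eval₂Hom β fun j => κ (X j)) =
      Ideal.span (Set.range fun i => C (α (X i)) - map (α.comp C) (f i)) := by
  have hKle : Ideal.span (Set.range fun i => C (α (X i)) - map (α.comp C) (f i)) ≤
      RingHom.ker (eval₂Hom β fun j => κ (X j)) := by
    rw [Ideal.span_le]
    rintro _ ⟨i, rfl⟩
    have h1 := congrArg (fun g => g (f i)) (MvPolynomial.eval₂Hom_comp_map_eq hcomm)
    have h2 := hcomm (X i)
    rw [aeval_X] at h2
    rw [SetLike.mem_coe, RingHom.mem_ker, map_sub, sub_eq_zero]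
    exact (eval₂Hom_C _ _ _).trans (h2.trans h1.symm)
  refine le_antisymm ?_ hKle
  · generalize hK : Ideal.span (Set.range fun i => C (α (X i)) - map (α.comp C) (f i)) = K at hKle ⊢
    let ψ : MvPolynomial (Fin n) k →+* MvPolynomial (Fin n) A ⧸ K :=
      (Ideal.Quotient.mk K).comp (map (α.comp C))
    have hψ : ∀ p, ψ (aeval f p) = Ideal.Quotient.mk K (C (α p)) := by
      intro p
      have h1 : ψ.comp (aeval f).toRingHom = (Ideal.Quotient.mk K).comp (C.comp α) := by
        ext i
        · simp [ψ]
        · have h2 : C (α (X i)) - map (α.comp C) (f i) ∈ K := hK ▸ Ideal.subset_span ⟨i, rfl⟩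
          have h3 := (Ideal.Quotient.eq.2 h2).symm
          simpa [ψ] using h3
      exact congrArg (fun g => g p) h1
    have hle : ∀ p ∈ RingHom.ker κ, ψ p = 0 := by
      suffices h1 : RingHom.ker κ ≤ RingHom.ker ψ from fun p hp => h1 hp
      rw [hker, Ideal.map_le_iff_le_comap]
      intro p hp
      rw [Ideal.mem_comap, RingHom.mem_ker]
      exact (hψ p).trans (by rw [(RingHom.mem_ker).1 hp, map_zero, map_zero])
    -- Modulo the graph equations a coefficient `α a` may be replaced by `aeval f a`, so every
    -- polynomial over `A` is congruent to one coming from `k[x]`. The kernel is then governed by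
    -- `ker κ`, which `ψ` kills.
    have hcomp : ∀ p, ∃ r, p - map (α.comp C) r ∈ K := by
      intro p
      obtain ⟨r, hr⟩ : ∃ r, Ideal.Quotient.mk K p = ψ r := by
        induction p using MvPolynomial.induction_on with
        | C a =>
          obtain ⟨a, rfl⟩ := hα a
          exact ⟨aeval f a, (hψ a).symm⟩
        | add p q hp hq =>
          obtain ⟨r, hr⟩ := hp
          obtain ⟨t, ht⟩ := hq
          exact ⟨r + t, by rw [map_add, map_add, hr, ht]⟩
        | mul_X p j hp =>
          obtain ⟨r, hr⟩ := hp
          exact ⟨r * X j, by rw [map_mul, map_mul, hr]; simp [ψ]⟩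
      exact ⟨r, Ideal.Quotient.eq.1 hr⟩
    intro p hp
    obtain ⟨r, hr⟩ := hcomp p
    have h1 := congrArg (fun g => g r) (MvPolynomial.eval₂Hom_comp_map_eq hcomm)
    have h2 := hKle hr
    rw [RingHom.mem_ker, map_sub, (RingHom.mem_ker).1 hp, zero_sub, neg_eq_zero] at h2
    have h3 := hle r ((RingHom.mem_ker).2 (h1.symm.trans h2))
    have h4 := K.add_mem hr (Ideal.Quotient.eq_zero_iff_mem.1 h3)
    rwa [sub_add_cancel] at h4

end BaseChange

/-- Cohen–Macaulayness of `S / I` and of its base change to `R`, for `R` free over `S`. -/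
theorem isCohenMacaulay_quotient_map_iff {k : Type*} [Field k] {s n : ℕ}
    {f : Fin s → MvPolynomial (Fin n) k}
    [Algebra (MvPolynomial (Fin s) k) (MvPolynomial (Fin n) k)]
    (halg : ∀ p, algebraMap (MvPolynomial (Fin s) k) (MvPolynomial (Fin n) k) p = aeval f p)
    [Module.Free (MvPolynomial (Fin s) k) (MvPolynomial (Fin n) k)]
    (I : Ideal (MvPolynomial (Fin s) k)) :
    IsCohenMacaulay (MvPolynomial (Fin s) k ⧸ I) ↔ IsCohenMacaulay (MvPolynomial (Fin n) k ⧸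
      I.map (algebraMap (MvPolynomial (Fin s) k) (MvPolynomial (Fin n) k))) := by
  refine ⟨fun h => ?_, fun h => ?_⟩
  · have hcomm : ∀ p, algebraMap (MvPolynomial (Fin s) k ⧸ I) (MvPolynomial (Fin n) k ⧸
        I.map (algebraMap (MvPolynomial (Fin s) k) (MvPolynomial (Fin n) k)))
          (Ideal.Quotient.mk I p) = Ideal.Quotient.mk _ (aeval f p) := fun p => by
      rw [Ideal.Quotient.algebraMap_quotient_map_quotient, halg]
    have hφμ := MvPolynomial.eval₂Hom_comp_map_eq hcomm
    -- Already the polynomials with coefficients from `k` map onto `R/J`.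
    have hφ := Function.Surjective.of_comp (f := fun p => eval₂Hom _ _ p)
      (g := map ((Ideal.Quotient.mk I).comp C)) (by
        rw [← RingHom.coe_comp, hφμ]
        exact Ideal.Quotient.mk_surjective)
    refine h.of_surjective_mvPolynomial hφ _ (MvPolynomial.ker_eval₂Hom_eq_span
      Ideal.Quotient.mk_surjective hcomm ?_) fun N hN => ?_
    · rw [Ideal.mk_ker, Ideal.mk_ker]
      exact congrArg Ideal.span (Set.image_congr fun p _ => halg p)
    have hcomp := MvPolynomial.eval₂Hom_comp_C
      (algebraMap (MvPolynomial (Fin s) k ⧸ I) (MvPolynomial (Fin n) k ⧸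
        I.map (algebraMap (MvPolynomial (Fin s) k) (MvPolynomial (Fin n) k))))
      (fun j => Ideal.Quotient.mk _ (X j))
    have := Ideal.comap_isMaximal_of_surjective _ hφ (K := N)
    have h2 := MvPolynomial.isMaximal_comap_C (N.comap (eval₂Hom (algebraMap
      (MvPolynomial (Fin s) k ⧸ I) (MvPolynomial (Fin n) k ⧸
        I.map (algebraMap (MvPolynomial (Fin s) k) (MvPolynomial (Fin n) k))))
      (fun j => Ideal.Quotient.mk _ (X j))))
    rw [Ideal.comap_comap, hcomp] at h2
    rw [hcomp]
    exact MvPolynomial.height_add_le_height_comap_add I N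
  · have : Module.FaithfullyFlat (MvPolynomial (Fin s) k ⧸ I) (MvPolynomial (Fin n) k ⧸
        I.map (algebraMap (MvPolynomial (Fin s) k) (MvPolynomial (Fin n) k))) :=
      .of_linearEquiv _ _
        (Algebra.TensorProduct.quotIdealMapEquivQuotTensor (MvPolynomial (Fin n) k) I).toLinearEquiv
    exact h.of_faithfullyFlat

/-! ### The theorem -/

theorem mainTheorem9 {k : Type*} [Field k] (s n r : ℕ)
    (f : Fin s → MvPolynomial (Fin (n + 1)) k)
    (hreg : RingTheory.Sequence.IsRegular (MvPolynomial (Fin (n + 1)) k) (List.ofFn f))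
    (e : Fin s → ℕ) (hf : ∀ i, (f i).IsHomogeneous (e i))
    (g : Fin r → MvPolynomial (Fin s) k)
    (I : Ideal (MvPolynomial (Fin s) k)) (hI : I = Ideal.span (Set.range g))
    (J : Ideal (MvPolynomial (Fin (n + 1)) k))
    (hJ : J = Ideal.span (Set.range fun i => MvPolynomial.aeval f (g i))) :
    -- forms of the same degree, homogeneous ideal
    (∀ d : ℕ, (∀ i, e i = d) → I.IsHomogeneous (MvPolynomial.homogeneousSubmodule (Fin s) k) →
      (∃ β : ℕ → ℕ → ℕ,
        HasGradedBettiNumbers (1 : Fin s → ℕ) (idealGrading 1 I) β ∧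
        HasGradedBettiNumbers (1 : Fin (n + 1) → ℕ) (idealGrading 1 J)
          (regradeBetti (fun j => d * j) β)) ∧
      (∃ β : ℕ → ℕ → ℕ,
        HasGradedBettiNumbers (1 : Fin s → ℕ) (quotientGrading 1 I) β ∧
        HasGradedBettiNumbers (1 : Fin (n + 1) → ℕ) (quotientGrading 1 J)
          (regradeBetti (fun j => d * j) β)) ∧
      (IsCohenMacaulay (MvPolynomial (Fin s) k ⧸ I) ↔
        IsCohenMacaulay (MvPolynomial (Fin (n + 1)) k ⧸ J))) ∧
    -- forms of arbitrary degrees, monomial ideal; `β` is the table of multigraded Betti numbers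
    (IsMonomialIdeal I →
      (∃ β : ℕ → (Fin s →₀ ℕ) → ℕ,
        HasGradedBettiNumbers (fun i => Finsupp.single i 1)
          (idealGrading (fun i => Finsupp.single i 1) I) β ∧
        HasGradedBettiNumbers (1 : Fin s → ℕ) (idealGrading 1 I)
          (regradeBetti (fun a => ∑ i, a i) β) ∧
        HasGradedBettiNumbers (1 : Fin (n + 1) → ℕ) (idealGrading 1 J)
          (regradeBetti (fun a => ∑ i, a i * e i) β)) ∧
      (∃ β : ℕ → (Fin s →₀ ℕ) → ℕ,
        HasGradedBettiNumbers (fun i => Finsupp.single i 1)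
          (quotientGrading (fun i => Finsupp.single i 1) I) β ∧
        HasGradedBettiNumbers (1 : Fin s → ℕ) (quotientGrading 1 I)
          (regradeBetti (fun a => ∑ i, a i) β) ∧
        HasGradedBettiNumbers (1 : Fin (n + 1) → ℕ) (quotientGrading 1 J)
          (regradeBetti (fun a => ∑ i, a i * e i) β)) ∧
      (IsCohenMacaulay (MvPolynomial (Fin s) k ⧸ I) ↔
        IsCohenMacaulay (MvPolynomial (Fin (n + 1)) k ⧸ J))) := by
  let : Algebra (MvPolynomial (Fin s) k) (MvPolynomial (Fin (n + 1)) k) :=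
    (MvPolynomial.aeval f).toRingHom.toAlgebra
  have halg : ∀ p, algebraMap (MvPolynomial (Fin s) k) (MvPolynomial (Fin (n + 1)) k) p =
    MvPolynomial.aeval f p := fun _ => rfl
  have hfree := free_of_isRegular_ofFn halg hreg hf
  have hJI : J = I.map (algebraMap (MvPolynomial (Fin s) k) (MvPolynomial (Fin (n + 1)) k)) := by
    -- `J` is the extension of `I`; from here on the chosen generators play no role.
    rw [hI, hJ, Ideal.map_span, ← Set.range_comp]
    rfl
  clear hI hJ g
  subst hJI
  have bas := Module.Free.chooseBasis (MvPolynomial (Fin s) k) (MvPolynomial (Fin (n + 1)) k)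
  refine ⟨fun d hd hI => ⟨?_, ?_, isCohenMacaulay_quotient_map_iff halg I⟩,
    fun hI => ⟨?_, ?_, isCohenMacaulay_quotient_map_iff halg I⟩⟩
  -- The table `β` is read off one resolution `F`; uniqueness makes it the Betti table of `I`, and
  -- base change transports the same `F` to `J`.
  · have hI' := hI.weightedHomogeneousComponent_mem
    obtain ⟨F⟩ := nonempty_resolution_idealGrading hI' eq_zero_of_weight_one_add_eq
    exact ⟨F.betti, hasGradedBettiNumbers_of_resolution (isGradedFamily_idealGrading hI') F
      fun _ _ => rfl, hasGradedBettiNumbers_idealGrading_map (φ := AddMonoidHom.mulLeft d)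
      (.of_isRegular_ofFn halg hreg hf fun i => by rw [hd]; exact mul_one d) bas hI' F⟩
  · have hI' := hI.weightedHomogeneousComponent_mem
    obtain ⟨F⟩ := nonempty_resolution_quotientGrading hI' eq_zero_of_weight_one_add_eq
    exact ⟨F.betti, hasGradedBettiNumbers_of_resolution (isGradedFamily_quotientGrading hI') F
      fun _ _ => rfl, hasGradedBettiNumbers_quotientGrading_map (φ := AddMonoidHom.mulLeft d)
      (.of_isRegular_ofFn halg hreg hf fun i => by rw [hd]; exact mul_one d) bas hI' F⟩
  · have hI' := hI.weightedHomogeneousComponent_mem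
    obtain ⟨F⟩ := nonempty_resolution_idealGrading hI' fun m a h => by
      rwa [weight_single_one, add_eq_right] at h
    exact ⟨F.betti, hasGradedBettiNumbers_of_resolution (isGradedFamily_idealGrading hI') F
      fun _ _ => rfl, hasGradedBettiNumbers_idealGrading_coarsen (φ := totalDegreeHom s)
      totalDegreeHom_single hI' F, hasGradedBettiNumbers_idealGrading_map (φ := weightHom e)
      (.of_isRegular_ofFn halg hreg hf (weightHom_single e)) bas hI' F⟩
  · have hI' := hI.weightedHomogeneousComponent_mem
    obtain ⟨F⟩ := nonempty_resolution_quotientGrading hI' fun m a h => by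
      rwa [weight_single_one, add_eq_right] at h
    exact ⟨F.betti, hasGradedBettiNumbers_of_resolution (isGradedFamily_quotientGrading hI') F
      fun _ _ => rfl, hasGradedBettiNumbers_quotientGrading_coarsen (φ := totalDegreeHom s)
      totalDegreeHom_single hI' F, hasGradedBettiNumbers_quotientGrading_map (φ := weightHom e)
      (.of_isRegular_ofFn halg hreg hf (weightHom_single e)) bas hI' F⟩
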